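/- Let $\Omega\subset\mathbb{R}^2$ be a bounded open set with smooth boundary, and let $G_\Omega$ be its Green's function with zero Dirichlet boundary conditions, that is, $$G_\Omega(x,y)=\frac{1}{2\pi}\log|x-y|^{-1}+g_\Omega(x,y),$$ where $g_\Omega$ is symmetric and, for each $y\in\Omega$, the function $x\mapsto g_\Omega(x,y)$ is harmonic in $\Omega$, continuous on $\overline\Omega$, and equal to $-\frac{1}{2\pi}\log|x-y|^{-1}$ for $x\in\partial\Omega$. For $n\ge 3$, $\alpha_1,\dots,\alpha_n\in(-\sqrt{4\pi},\sqrt{4\pi})$ and complex-valued $f_3,\dots,f_n\in C_c^\infty(\Omega)$, write $\|\alpha\|=\max_{1\le i\le n}|\alpha_i|$ and, for distinct $x_1,x_2\in\Omega$, $$H_n(x_1,x_2)=\int_{\Omega^{n-2}}d^2x_3\cdots d^2x_n\,\prod_{j=3}^n f_j(x_j)\;e^{-\sum_{1\le k<l\le n}\alpha_k\alpha_l G_\Omega(x_k,x_l)}.$$ Then for each compact $K\subset\Omega$ there exists a constant $C>0$, depending only on $K$, $\Omega$, $\|\alpha\|$, $\bigcup_{i=3}^n\mathrm{supp}(f_i)$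 and $\max_i\|f_i\|_{L^\infty(\Omega)}$ (in particular not otherwise on $n$), such that for all $x_1,x_2\in K$ with $x_1\ne x_2$ the integral defining $H_n(x_1,x_2)$ converges absolutely and $$|H_n(x_1,x_2)|\le |x_1-x_2|^{-\frac{\|\alpha\|^2}{2\pi}}\,C^n\,n^{\frac{\|\alpha\|^2}{8\pi}n}.$$ -/

import Mathlib

open MeasureTheory InnerProductSpace
open scoped ENNReal ContDiff

/-- The boundary of the planar open set `Ω` is smooth: near each of its boundary points, `Ω` is
the set where a smooth real function with non-vanishing derivative is negative.
The plane `ℝ²` is identified with `ℂ` throughout. -/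
def HasSmoothBoundary (Ω : Set ℂ) : Prop :=
  ∀ p ∈ frontier Ω, ∃ (U : Set ℂ) (ρ : ℂ → ℝ), IsOpen U ∧ p ∈ U ∧ ContDiffOn ℝ ∞ ρ U ∧
    fderiv ℝ ρ p ≠ 0 ∧ Ω ∩ U = {z | z ∈ U ∧ ρ z < 0}

/-- `g` is the regular part of the Dirichlet Green's function of `Ω`: for each `y ∈ Ω`, the
function `x ↦ g x y` is the classical solution of the Dirichlet problem in `Ω` with boundary
values `-(1 / 2π) log |x - y|⁻¹`, and `g` is symmetric. -/
structure IsGreenRegularPart (Ω : Set ℂ) (g : ℂ → ℂ → ℝ) : Prop where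
  harmonic : ∀ y ∈ Ω, HarmonicContOnCl (fun x => g x y) Ω
  boundary : ∀ y ∈ Ω, ∀ x ∈ frontier Ω, g x y = -((2 * Real.pi)⁻¹ * Real.log ‖x - y‖⁻¹)
  symm : ∀ x ∈ Ω, ∀ y ∈ Ω, g x y = g y x

/-- The regular part is determined by `Ω` on `closure Ω × Ω`. -/
theorem IsGreenRegularPart.unique {Ω : Set ℂ} (hΩ : IsOpen Ω) (hb : Bornology.IsBounded Ω)
    {g g' : ℂ → ℂ → ℝ} (hg : IsGreenRegularPart Ω g) (hg' : IsGreenRegularPart Ω g')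
    {x y : ℂ} (hx : x ∈ closure Ω) (hy : y ∈ Ω) : g x y = g' x y := by
  have key : ∀ h : ℂ → ℝ, HarmonicContOnCl h Ω → (∀ z ∈ frontier Ω, h z = 0) →
      ∀ z ∈ closure Ω, h z ≤ 0 := by
    intro h hh h0 z hz
    by_contra! hpos
    have hc : IsCompact (closure Ω) := hb.isCompact_closure
    obtain ⟨m, hm, hmax⟩ := hc.exists_isMaxOn ⟨z, hz⟩ hh.continuousOn
    have hmpos : 0 < h m := lt_of_lt_of_le hpos (hmax hz)
    -- among the maximum points, one with the largest real part
    have hA : IsCompact (closure Ω ∩ h ⁻¹' {h m}) :=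
      hc.of_isClosed_subset
        (hh.continuousOn.preimage_isClosed_of_isClosed isClosed_closure isClosed_singleton)
        Set.inter_subset_left
    obtain ⟨a, ⟨ha, ham⟩, hamax⟩ := hA.exists_isMaxOn ⟨m, hm, rfl⟩
      Complex.continuous_re.continuousOn
    have ham' : h a = h m := ham
    have haΩ : a ∈ Ω := by
      by_contra hna
      have : a ∈ frontier Ω := by
        rw [hΩ.frontier_eq]; exact ⟨ha, hna⟩
      have := h0 a this
      linarith
    obtain ⟨r, hr, hball⟩ := Metric.isOpen_iff.1 hΩ a haΩ
    obtain ⟨F, hF, hFe⟩ :=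
      HarmonicOnNhd.exists_analyticOnNhd_ball_re_eq (hh.harmonicOnNhd.mono hball)
    have hr2 : Metric.closedBall a (r / 2) ⊆ Metric.ball a r :=
      Metric.closedBall_subset_ball (by linarith)
    have hd : DiffContOnCl ℂ (fun w => Complex.exp (F w)) (Metric.ball a (r / 2)) := by
      apply DifferentiableOn.diffContOnCl
      intro w hw
      rw [closure_ball _ (by linarith)] at hw
      exact (hF w (hr2 hw)).differentiableAt.cexp.differentiableWithinAt
    have hre : ∀ w ∈ Metric.ball a r, (F w).re = h w := fun w hw => hFe hw
    have hmx : IsMaxOn (norm ∘ fun w => Complex.exp (F w)) (Metric.ball a (r / 2)) a := by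
      intro w hw
      have hw' := Metric.ball_subset_ball (by linarith : r / 2 ≤ r) hw
      simp only [Set.mem_ofPred_eq, Function.comp, Complex.norm_exp]
      rw [hre w hw', hre a (Metric.mem_ball_self hr), ham']
      exact Real.exp_le_exp.2 (hmax (subset_closure (hball hw')))
    have heq := Complex.norm_eqOn_closedBall_of_isMaxOn hd hmx
    have hp : a + (r / 2 : ℝ) ∈ Metric.closedBall a (r / 2) := by
      simp [abs_of_pos hr]
    have hp' := hr2 hp
    have h1 := heq hp
    simp only [Function.comp, Complex.norm_exp, Real.exp_eq_exp, Function.const] at h1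
    rw [hre _ hp', hre a (Metric.mem_ball_self hr), ham'] at h1
    have h2 := hamax (show a + (r / 2 : ℝ) ∈ closure Ω ∩ h ⁻¹' {h m} from
      ⟨subset_closure (hball hp'), h1⟩)
    simp at h2
    linarith
  have hd : ∀ g₁ g₂ : ℂ → ℂ → ℝ, IsGreenRegularPart Ω g₁ → IsGreenRegularPart Ω g₂ →
      g₁ x y ≤ g₂ x y := by
    intro g₁ g₂ h₁ h₂
    have := key (fun z => g₁ z y - g₂ z y)
      ⟨(h₁.harmonic y hy).harmonicOnNhd.sub (h₂.harmonic y hy).harmonicOnNhd,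
        (h₁.harmonic y hy).continuousOn.sub (h₂.harmonic y hy).continuousOn⟩
      (fun z hz => by simp [h₁.boundary y hy z hz, h₂.boundary y hy z hz]) x hx
    simpa using this
  exact le_antisymm (hd g g' hg hg') (hd g' g hg' hg)

open Classical in
/-- The Green's function `G_Ω(x, y) = (1 / 2π) log |x - y|⁻¹ + g_Ω(x, y)` of `Ω` with zero
Dirichlet boundary conditions, for `x, y ∈ Ω` distinct. A bounded open set with smooth boundary
has a regular part `g_Ω`, and the preceding lemma says that it is unique; only for sets without
one is the second branch used. -/
noncomputable def greenFunction (Ω : Set ℂ) (x y : ℂ) : ℝ :=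
  if h : ∃ g, IsGreenRegularPart Ω g then
    (2 * Real.pi)⁻¹ * Real.log ‖x - y‖⁻¹ + h.choose x y
  else 0

/-- `f ∈ C_c^∞(Ω)`, complex valued. -/
def IsTestFunction (Ω : Set ℂ) (f : ℂ → ℂ) : Prop :=
  ContDiff ℝ ∞ f ∧ HasCompactSupport f ∧ tsupport f ⊆ Ω

/-- The Boltzmann weight `exp (-∑_{k < l} α_k α_l G_Ω(x_k, x_l))` of `n` charges. -/
noncomputable def coulombWeight (Ω : Set ℂ) {n : ℕ} (α : Fin n → ℝ) (x : Fin n → ℂ) : ℝ :=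
  Real.exp (-∑ k, ∑ l ∈ Finset.Ioi k, α k * α l * greenFunction Ω (x k) (x l))

/-- The integrand of `coulombTwoPoint` as a function of the free points `y = (x_3, …, x_n)`, where
`n = m + 2`; the test functions are `f = (f_3, …, f_n)`. -/
noncomputable def coulombIntegrand (Ω : Set ℂ) {m : ℕ} (α : Fin (m + 2) → ℝ)
    (f : Fin m → ℂ → ℂ) (x₁ x₂ : ℂ) (y : Fin m → ℂ) : ℂ :=
  (∏ j, f j (y j)) * (coulombWeight Ω α (Fin.cons x₁ (Fin.cons x₂ y)) : ℂ)

/-- `H_n(x_1, x_2)` for `n = m + 2`: all points but the first two are integrated over `Ω`. -/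
noncomputable def coulombTwoPoint (Ω : Set ℂ) {m : ℕ} (α : Fin (m + 2) → ℝ)
    (f : Fin m → ℂ → ℂ) (x₁ x₂ : ℂ) : ℂ :=
  ∫ y in Set.univ.pi (fun _ : Fin m => Ω), coulombIntegrand Ω α f x₁ x₂ y

/-!
By Newton's theorem each charge `α k` may be smeared out over a disc of radius `r k` without
changing the interactions, as long as the discs are disjoint. The Dirichlet energy of the smeared
configuration is nonnegative, so the interaction energy is at least minus the sum of the
self-energies (Onsager's inequality). With radii proportional to the distance `D k` from `x k` to
its nearest neighbour, the Boltzmann weight is at most `C ^ n * ∏ k, D k ^ (-β)`, where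
`β = ‖α‖² / (4π) < 1`.

To integrate this product, consider the points whose nearest neighbour is the farthest. Either one
of them is not the only nearest neighbour of any other point, or two of them are only each other's
nearest neighbours. Removing this point or this pair leaves the remaining distances unchanged, and
the factors removed are at most a kernel `(s / d) ^ (2 * β)`, which is integrable in the plane. All
remaining distances are at most `d`; carrying this constraint along as a factor
`exp (n * (d / s) ^ (2 - 2 * β))`, the integration of the kernel gains `s ^ 2 / n`, which for
`s = n ^ (-1 / 2)` compensates for the `n ^ 2` choices of a pair. Writing the weight in units of `s`
costs `s ^ (-β * n) = n ^ (β * n / 2)`.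
-/

section NearestNeighbour

variable {ι E : Type*} [DecidableEq ι] [PseudoEMetricSpace E] {A A' : Finset ι} {x : ι → E}
  {i j k : ι}

/-- The distance from `x i` to the other points of the configuration `x` with index in `A`; it is
`⊤` if there are none. -/
noncomputable def nearestDist (A : Finset ι) (x : ι → E) (i : ι) : ℝ≥0∞ :=
  ⨅ j ∈ A.erase i, edist (x i) (x j)

lemma nearestDist_le (hj : j ∈ A) (hji : j ≠ i) : nearestDist A x i ≤ edist (x i) (x j) :=
  iInf₂_le_of_le j (Finset.mem_erase.2 ⟨hji, hj⟩) le_rfl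

lemma nearestDist_anti (h : A' ⊆ A) (x : ι → E) (i : ι) :
    nearestDist A x i ≤ nearestDist A' x i :=
  biInf_mono fun _ hj => Finset.erase_subset_erase _ h hj

lemma exists_nearestDist_eq (h : nearestDist A x i ≠ ⊤) :
    ∃ j ∈ A, j ≠ i ∧ nearestDist A x i = edist (x i) (x j) := by
  have hne : (A.erase i).Nonempty := by
    by_contra hne
    rw [Finset.not_nonempty_iff_eq_empty] at hne
    exact h (by simp [nearestDist, hne])
  obtain ⟨j, hj, hmin⟩ := Finset.exists_min_image (A.erase i) (fun j => edist (x i) (x j)) hne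
  obtain ⟨hji, hjA⟩ := Finset.mem_erase.1 hj
  exact ⟨j, hjA, hji, le_antisymm (nearestDist_le hjA hji) (le_iInf₂ hmin)⟩

lemma nearestDist_eq_of_subset (h : A' ⊆ A) (hj : j ∈ A') (hji : j ≠ i)
    (hD : nearestDist A x i = edist (x i) (x j)) : nearestDist A' x i = nearestDist A x i :=
  le_antisymm (hD ▸ nearestDist_le hj hji) (nearestDist_anti h x i)

/-- `x i` is the only nearest neighbour of `x k` among the points with index in `A`, expressed by
the fact that its removal increases the nearest neighbour distance of `x k`. -/
def IsUniqueNearest (A : Finset ι) (x : ι → E) (i k : ι) : Prop :=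
  nearestDist A x k < nearestDist (A.erase i) x k

lemma IsUniqueNearest.eq_of_edist_le (h : IsUniqueNearest A x i k) (hj : j ∈ A) (hjk : j ≠ k)
    (hd : edist (x k) (x j) ≤ nearestDist A x k) : j = i := by
  by_contra hji
  exact (h.trans_le (nearestDist_le (Finset.mem_erase.2 ⟨hji, hj⟩) hjk)).not_ge hd

lemma IsUniqueNearest.mem_and_ne_and_eq (h : IsUniqueNearest A x i k) :
    i ∈ A ∧ i ≠ k ∧ nearestDist A x k = edist (x k) (x i) := by
  obtain ⟨j, hj, hjk, hD⟩ := exists_nearestDist_eq h.ne_top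
  obtain rfl := h.eq_of_edist_le hj hjk hD.ge
  exact ⟨hj, hjk, hD⟩

lemma IsUniqueNearest.left_unique (h : IsUniqueNearest A x i k) (h' : IsUniqueNearest A x j k) :
    i = j :=
  have ⟨hi, hik, hD⟩ := h.mem_and_ne_and_eq
  h'.eq_of_edist_le hi hik hD.ge

/-- The map sending a maximiser `i` of the nearest neighbour distance to a point whose unique
nearest neighbour is `i` is an injection of the finite set of maximisers into itself, hence
surjective, which makes the nearest neighbour relation symmetric on it. -/
lemma exists_mutual_isUniqueNearest {i₀ : ι} (hi₀ : i₀ ∈ A)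
    (hmax : ∀ k ∈ A, nearestDist A x k ≤ nearestDist A x i₀)
    (h : ∀ i ∈ A, nearestDist A x i = nearestDist A x i₀ → ∃ k ∈ A, IsUniqueNearest A x i k) :
    ∃ j, IsUniqueNearest A x i₀ j ∧ IsUniqueNearest A x j i₀ := by
  let T := {i // i ∈ A ∧ nearestDist A x i = nearestDist A x i₀}
  have : Finite T := (A.finite_toSet.subset fun _ hi => hi.1).to_subtype
  have next : ∀ i : T, ∃ k : T, IsUniqueNearest A x i k := by
    rintro ⟨i, hiA, hi⟩
    obtain ⟨k, hkA, hk⟩ := h i hiA hi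
    obtain ⟨-, hik, hD⟩ := hk.mem_and_ne_and_eq
    refine ⟨⟨k, hkA, (hmax k hkA).antisymm ?_⟩, hk⟩
    rw [← hi, hD, edist_comm]
    exact nearestDist_le hkA hik.symm
  choose κ hκ using next
  have κ_injective : Function.Injective κ := fun i i' hii =>
    Subtype.ext ((hκ i).left_unique (hii ▸ hκ i'))
  obtain ⟨j, hj⟩ := Finite.surjective_of_injective κ_injective ⟨i₀, hi₀, rfl⟩
  have hji₀ : IsUniqueNearest A x j i₀ := by simpa only [hj] using hκ j
  obtain ⟨-, hne, hD⟩ := (hκ ⟨i₀, hi₀, rfl⟩).mem_and_ne_and_eq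
  have hκj : (κ ⟨i₀, hi₀, rfl⟩ : ι) = j := by
    refine hji₀.eq_of_edist_le (κ ⟨i₀, hi₀, rfl⟩).2.1 hne.symm ?_
    rw [edist_comm, ← hD]
    exact (κ ⟨i₀, hi₀, rfl⟩).2.2.le
  exact ⟨j, hκj ▸ hκ ⟨i₀, hi₀, rfl⟩, hji₀⟩

lemma nearestDist_erase_erase_of_mutual (hij : IsUniqueNearest A x i j)
    (hji : IsUniqueNearest A x j i) (hmax : ∀ k ∈ A, nearestDist A x k ≤ nearestDist A x i)
    (hk : k ∈ (A.erase i).erase j) (hfin : nearestDist A x k ≠ ⊤) :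
    nearestDist ((A.erase i).erase j) x k = nearestDist A x k := by
  obtain ⟨hkj, hki, hkA⟩ : k ≠ j ∧ k ≠ i ∧ k ∈ A := by simpa only [Finset.mem_erase] using hk
  obtain ⟨-, hne, hDj⟩ := hij.mem_and_ne_and_eq
  obtain ⟨-, -, hDi⟩ := hji.mem_and_ne_and_eq
  obtain ⟨l, hl, hlk, hD⟩ := exists_nearestDist_eq hfin
  have hli : l ≠ i := by
    rintro rfl
    refine hkj (hji.eq_of_edist_le hkA hki ?_)
    rw [edist_comm, ← hD]
    exact hmax k hkA
  have hlj : l ≠ j := by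
    rintro rfl
    refine hki (hij.eq_of_edist_le hkA hkj ?_)
    rw [edist_comm, ← hD, hDj, edist_comm, ← hDi]
    exact hmax k hkA
  exact nearestDist_eq_of_subset ((Finset.erase_subset _ _).trans (Finset.erase_subset _ _))
    (Finset.mem_erase.2 ⟨hlj, Finset.mem_erase.2 ⟨hli, hl⟩⟩) hlk hD

lemma exists_removable (hA : A.Nonempty) (hfin : ∀ i ∈ A, nearestDist A x i ≠ ⊤) :
    ∃ i ∈ A, (∀ k ∈ A, nearestDist A x k ≤ nearestDist A x i) ∧
      ((∀ k ∈ A.erase i, nearestDist (A.erase i) x k = nearestDist A x k) ∨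
        ∃ j ∈ A.erase i, nearestDist A x i = edist (x i) (x j) ∧
          nearestDist A x j = edist (x i) (x j) ∧
          ∀ k ∈ (A.erase i).erase j,
            nearestDist ((A.erase i).erase j) x k = nearestDist A x k) := by
  obtain ⟨i₀, hi₀, hmax⟩ := Finset.exists_max_image A (nearestDist A x) hA
  by_cases hrem : ∃ i ∈ A, nearestDist A x i = nearestDist A x i₀ ∧
      ∀ k ∈ A.erase i, nearestDist (A.erase i) x k = nearestDist A x k
  · obtain ⟨i, hi, him, hk⟩ := hrem
    exact ⟨i, hi, fun k hk => him ▸ hmax k hk, Or.inl hk⟩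
  · push Not at hrem
    obtain ⟨j, hij, hji⟩ := exists_mutual_isUniqueNearest hi₀ hmax fun i hi him => by
      obtain ⟨k, hk, hne⟩ := hrem i hi him
      exact ⟨k, Finset.mem_of_mem_erase hk,
        (nearestDist_anti (Finset.erase_subset _ _) x k).lt_of_ne hne.symm⟩
    obtain ⟨hjA, hne, hDi⟩ := hji.mem_and_ne_and_eq
    refine ⟨i₀, hi₀, hmax, Or.inr ⟨j, Finset.mem_erase.2 ⟨hne, hjA⟩, hDi, ?_, fun k hk => ?_⟩⟩
    · rw [edist_comm]
      exact hij.mem_and_ne_and_eq.2.2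
    · exact nearestDist_erase_erase_of_mutual hij hji hmax hk
        (hfin k (Finset.mem_of_mem_erase (Finset.mem_of_mem_erase hk)))

/-- The power `(s / d) ^ γ` of a scale over a distance, cut off at distances greater than `t`. -/
noncomputable def cutPower (s : ℝ≥0∞) (γ : ℝ) (t d : ℝ≥0∞) : ℝ≥0∞ :=
  if d ≤ t then (s / d) ^ γ else 0

lemma cutPower_le (s : ℝ≥0∞) (γ : ℝ) (t d : ℝ≥0∞) : cutPower s γ t d ≤ (s / d) ^ γ := by
  rw [cutPower]
  split_ifs
  exacts [le_rfl, zero_le]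

@[fun_prop]
lemma measurable_cutPower {X : Type*} [MeasurableSpace X] {t d : X → ℝ≥0∞} (ht : Measurable t)
    (hd : Measurable d) (s : ℝ≥0∞) (γ : ℝ) : Measurable fun a => cutPower s γ (t a) (d a) :=
  Measurable.ite (measurableSet_le hd ht) ((hd.const_div s).pow_const γ) measurable_const

lemma one_le_ennreal_div {s d : ℝ≥0∞} (hs0 : s ≠ 0) (hs : s ≠ ⊤) (h : d ≤ s) : 1 ≤ s / d := by
  rwa [ENNReal.le_div_iff_mul_le (Or.inr hs0) (Or.inr hs), one_mul]

lemma cutPower_le_cutPower_two_mul {s t : ℝ≥0∞} {β : ℝ} (hs0 : s ≠ 0) (hs : s ≠ ⊤) (ht : t ≤ s)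
    (hβ : 0 ≤ β) (d : ℝ≥0∞) : cutPower s β t d ≤ cutPower s (2 * β) t d := by
  rw [cutPower, cutPower]
  split_ifs with hd
  · exact ENNReal.rpow_le_rpow_of_exponent_le (one_le_ennreal_div hs0 hs (hd.trans ht))
      (by linarith)
  · exact le_rfl

/-- The product over `A` of the weights `(s / D) ^ β`, where `D` is the distance to the nearest
neighbour in `A`, on the set where all these distances are at most `t`. -/
noncomputable def nearestWeight (s : ℝ≥0∞) (β : ℝ) (A : Finset ι) (t : ℝ≥0∞) (x : ι → E) : ℝ≥0∞ :=
  ∏ i ∈ A, cutPower s β t (nearestDist A x i)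

lemma nearestWeight_eq_of_le {s t : ℝ≥0∞} {β : ℝ} (h : ∀ i ∈ A, nearestDist A x i ≤ t) :
    nearestWeight s β A t x = ∏ i ∈ A, (s / nearestDist A x i) ^ β :=
  Finset.prod_congr rfl fun i hi => if_pos (h i hi)

lemma nearestWeight_of_subset {s t : ℝ≥0∞} {β : ℝ}
    (hD : ∀ k ∈ A', nearestDist A' x k = nearestDist A x k)
    (ht : ∀ k ∈ A', nearestDist A x k ≤ t) :
    nearestWeight s β A' t x = ∏ k ∈ A', (s / nearestDist A x k) ^ β := by
  rw [nearestWeight_eq_of_le fun k hk => (hD k hk).trans_le (ht k hk)]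
  exact Finset.prod_congr rfl fun k hk => by rw [hD k hk]

lemma exists_nearestWeight_le {s t : ℝ≥0∞} {β : ℝ} (hs0 : s ≠ 0) (hs : s ≠ ⊤) (ht : t ≤ s)
    (hβ : 0 ≤ β) (hA : A.Nonempty) (h : ∀ i ∈ A, nearestDist A x i ≤ t) :
    ∃ i ∈ A, ∃ j ∈ A.erase i, nearestWeight s β A t x ≤
      cutPower s (2 * β) t (edist (x i) (x j)) *
        (nearestWeight s β (A.erase i) (edist (x i) (x j)) x +
          nearestWeight s β ((A.erase i).erase j) (edist (x i) (x j)) x) := by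
  have hfin : ∀ i ∈ A, nearestDist A x i ≠ ⊤ := fun i hi =>
    ne_top_of_le_ne_top hs ((h i hi).trans ht)
  rw [nearestWeight_eq_of_le h]
  obtain ⟨i, hi, hmax, hD | ⟨j, hj, hDi, hDj, hD⟩⟩ := exists_removable hA hfin
  · obtain ⟨j, hj, hji, hDi⟩ := exists_nearestDist_eq (hfin i hi)
    refine ⟨i, hi, j, Finset.mem_erase.2 ⟨hji, hj⟩, ?_⟩
    rw [← hDi, ← Finset.mul_prod_erase A _ hi, nearestWeight_of_subset hD fun k hk =>
      hmax k (Finset.mem_of_mem_erase hk)]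
    refine mul_le_mul' ?_ le_self_add
    exact (if_pos (h i hi)).ge.trans (cutPower_le_cutPower_two_mul hs0 hs ht hβ _)
  · refine ⟨i, hi, j, hj, ?_⟩
    rw [← hDi] at hDj ⊢
    rw [nearestWeight_of_subset hD fun k hk =>
        hmax k (Finset.mem_of_mem_erase (Finset.mem_of_mem_erase hk)),
      ← Finset.mul_prod_erase A _ hi, ← Finset.mul_prod_erase _ _ hj, hDj, ← mul_assoc,
      ← ENNReal.rpow_add_of_nonneg _ _ hβ hβ, ← two_mul, cutPower, if_pos (h i hi)]
    exact mul_le_mul' le_rfl le_add_self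

lemma nearestWeight_le_sum {s t : ℝ≥0∞} {β : ℝ} (hs0 : s ≠ 0) (hs : s ≠ ⊤) (ht : t ≤ s)
    (hβ : 0 ≤ β) (hA : A.Nonempty) (x : ι → E) :
    nearestWeight s β A t x ≤ ∑ i ∈ A, ∑ j ∈ A.erase i,
      cutPower s (2 * β) t (edist (x i) (x j)) *
        (nearestWeight s β (A.erase i) (edist (x i) (x j)) x +
          nearestWeight s β ((A.erase i).erase j) (edist (x i) (x j)) x) := by
  by_cases h : ∀ i ∈ A, nearestDist A x i ≤ t
  · obtain ⟨i, hi, j, hj, hle⟩ := exists_nearestWeight_le hs0 hs ht hβ hA h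
    refine hle.trans (le_trans ?_ (Finset.single_le_sum (fun _ _ => zero_le) hi))
    exact Finset.single_le_sum (f := fun j => cutPower s (2 * β) t (edist (x i) (x j)) *
        (nearestWeight s β (A.erase i) (edist (x i) (x j)) x +
          nearestWeight s β ((A.erase i).erase j) (edist (x i) (x j)) x))
      (fun _ _ => zero_le) hj
  · push Not at h
    obtain ⟨i, hi, hlt⟩ := h
    exact (Finset.prod_eq_zero hi (if_neg hlt.not_ge)).trans_le zero_le

/-- The points whose nearest neighbour is at distance at most `s` carry the whole product. -/
lemma prod_max_le_sum_nearestWeight [Fintype ι] {s : ℝ≥0∞} {β : ℝ} (hs0 : s ≠ 0) (hs : s ≠ ⊤)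
    (x : ι → E) :
    ∏ i, (max 1 (s / nearestDist Finset.univ x i)) ^ β ≤
      ∑ A : Finset ι, nearestWeight s β A s x := by
  classical
  set A := Finset.univ.filter fun i => nearestDist Finset.univ x i ≤ s with hA
  have mem_A : ∀ {i}, i ∈ A ↔ nearestDist Finset.univ x i ≤ s := by simp [hA]
  have hD : ∀ i ∈ A, nearestDist A x i = nearestDist Finset.univ x i := by
    intro i hi
    obtain ⟨j, -, hji, hDi⟩ := exists_nearestDist_eq (ne_top_of_le_ne_top hs (mem_A.1 hi))
    refine nearestDist_eq_of_subset (Finset.subset_univ _) (mem_A.2 ?_) hji hDi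
    calc nearestDist Finset.univ x j ≤ edist (x j) (x i) :=
          nearestDist_le (Finset.mem_univ _) hji.symm
      _ = nearestDist Finset.univ x i := by rw [edist_comm, hDi]
      _ ≤ s := mem_A.1 hi
  calc ∏ i, (max 1 (s / nearestDist Finset.univ x i)) ^ β
      = ∏ i ∈ A, (max 1 (s / nearestDist Finset.univ x i)) ^ β := by
        refine (Finset.prod_subset (Finset.subset_univ A) fun i _ hi => ?_).symm
        have hlt : s < nearestDist Finset.univ x i := not_le.1 (mt mem_A.2 hi)
        rw [max_eq_left, ENNReal.one_rpow]
        exact ENNReal.div_le_of_le_mul (by rw [one_mul]; exact hlt.le)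
    _ = ∏ i ∈ A, (s / nearestDist Finset.univ x i) ^ β :=
        Finset.prod_congr rfl fun i hi => by
          rw [max_eq_right (one_le_ennreal_div hs0 hs (mem_A.1 hi))]
    _ = nearestWeight s β A s x :=
        (nearestWeight_of_subset hD fun i hi => mem_A.1 hi).symm
    _ ≤ ∑ A : Finset ι, nearestWeight s β A s x :=
        Finset.single_le_sum (f := fun A => nearestWeight s β A s x)
          (fun _ _ => zero_le) (Finset.mem_univ A)

end NearestNeighbour

section PlanarIntegrals

open Set

lemma lintegral_comp_norm_complex {g : ℝ → ℝ≥0∞} (hg : Measurable g) :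
    ∫⁻ z : ℂ, g ‖z‖ =
      ENNReal.ofReal (2 * Real.pi) * ∫⁻ r in Ioi (0 : ℝ), ENNReal.ofReal r * g r := by
  have polar_eq : ∀ p ∈ Ioi (0 : ℝ) ×ˢ Ioo (-Real.pi) Real.pi,
      ENNReal.ofReal p.1 • g ‖Complex.polarCoord.symm p‖ = ENNReal.ofReal p.1 * g p.1 := by
    intro p hp
    rw [Complex.norm_polarCoord_symm, abs_of_pos hp.1, smul_eq_mul]
  rw [← Complex.lintegral_comp_polarCoord_symm, polarCoord_target,
    setLIntegral_congr_fun (measurableSet_Ioi.prod measurableSet_Ioo) polar_eq,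
    Measure.volume_eq_prod, setLIntegral_prod _ (by fun_prop)]
  simp only [lintegral_const, Measure.restrict_apply MeasurableSet.univ, univ_inter,
    Real.volume_Ioo]
  rw [lintegral_mul_const _ (by fun_prop), mul_comm, sub_neg_eq_add, ← two_mul]

lemma lintegral_Ioc_deriv_eq_sub {F F' : ℝ → ℝ} {a b : ℝ} (hab : a ≤ b)
    (hcont : ContinuousOn F (Icc a b)) (hderiv : ∀ r ∈ Ioo a b, HasDerivAt F (F' r) r)
    (hnonneg : ∀ r ∈ Ioo a b, 0 ≤ F' r) :
    ∫⁻ r in Ioc a b, ENNReal.ofReal (F' r) = ENNReal.ofReal (F b - F a) := by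
  have hint := intervalIntegral.integrableOn_deriv_of_nonneg hcont hderiv hnonneg
  have hae : 0 ≤ᵐ[volume.restrict (Ioc a b)] F' := by
    rw [← restrict_Ioo_eq_restrict_Ioc]
    filter_upwards [ae_restrict_mem measurableSet_Ioo] with r hr using hnonneg r hr
  rw [← ofReal_integral_eq_lintegral_ofReal hint hae, ← intervalIntegral.integral_of_le hab,
    intervalIntegral.integral_eq_sub_of_hasDerivAt_of_le hab hcont hderiv
      ((intervalIntegrable_iff_integrableOn_Ioc_of_le hab).2 hint)]

/-- The weight `exp (lam (t / s) ^ (2 - γ))`. Its derivative in `t` is, up to a constant, the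
product of the weight and the radial density `t (s / t) ^ γ`, so that integration against the
kernel `(s / t) ^ γ` reproduces it with a gain of `1 / lam`. -/
noncomputable def radialGrowth (lam s γ : ℝ) (t : ℝ≥0∞) : ℝ≥0∞ :=
  ENNReal.ofReal (Real.exp (lam * (t.toReal / s) ^ (2 - γ)))

@[fun_prop]
lemma measurable_radialGrowth (lam s γ : ℝ) : Measurable (radialGrowth lam s γ) := by
  unfold radialGrowth
  fun_prop

lemma one_le_radialGrowth {lam s : ℝ} (hlam : 0 ≤ lam) (hs : 0 ≤ s) (γ : ℝ) (t : ℝ≥0∞) :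
    1 ≤ radialGrowth lam s γ t := by
  rw [radialGrowth, ← ENNReal.ofReal_one]
  exact ENNReal.ofReal_le_ofReal (Real.one_le_exp (by positivity))

lemma radialGrowth_mono {lam s γ : ℝ} (hlam : 0 ≤ lam) (hs : 0 ≤ s) (hγ : γ ≤ 2) {t t' : ℝ≥0∞}
    (h : t ≤ t') (ht' : t' ≠ ⊤) : radialGrowth lam s γ t ≤ radialGrowth lam s γ t' := by
  have := ENNReal.toReal_mono ht' h
  refine ENNReal.ofReal_le_ofReal (Real.exp_le_exp.2 ?_)
  gcongr

lemma radialGrowth_self {lam s : ℝ} (hs : 0 < s) (γ : ℝ) :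
    radialGrowth lam s γ (ENNReal.ofReal s) = ENNReal.ofReal (Real.exp lam) := by
  rw [radialGrowth, ENNReal.toReal_ofReal hs.le, div_self hs.ne', Real.one_rpow, mul_one]

lemma hasDerivAt_exp_mul_div_rpow {lam s γ r : ℝ} (hs : 0 < s) (hr : 0 < r) :
    HasDerivAt (fun r => Real.exp (lam * (r / s) ^ (2 - γ)))
      ((2 - γ) * lam / s ^ 2 * (r * ((s / r) ^ γ * Real.exp (lam * (r / s) ^ (2 - γ))))) r := by
  have hdiv : HasDerivAt (fun r : ℝ => r / s) (1 / s) r := (hasDerivAt_id r).div_const s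
  have hpow := hdiv.rpow_const (p := 2 - γ) (Or.inl (div_pos hr hs).ne')
  convert (hpow.const_mul lam).exp using 1
  have hexp : (r / s) ^ (2 - γ - 1) = (s / r) ^ γ * (r / s) := by
    rw [← inv_div r s, Real.inv_rpow (by positivity), ← Real.rpow_neg (by positivity),
      ← Real.rpow_add_one (by positivity)]
    ring_nf
  rw [hexp]
  field_simp

lemma ofReal_mul_cutPower_mul_radialGrowth {lam s γ : ℝ} (hlam : 0 < lam) (hs : 0 < s)
    (hγ : γ < 2) (t : NNReal) {r : ℝ} (hr : 0 < r) :
    ENNReal.ofReal r * (cutPower (ENNReal.ofReal s) γ t (ENNReal.ofReal r) *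
        radialGrowth lam s γ (ENNReal.ofReal r)) =
      (Ioc 0 (t : ℝ)).indicator (fun r => ENNReal.ofReal (s ^ 2 / ((2 - γ) * lam)) *
        ENNReal.ofReal ((2 - γ) * lam / s ^ 2 *
          (r * ((s / r) ^ γ * Real.exp (lam * (r / s) ^ (2 - γ)))))) r := by
  have hγ' : 0 < 2 - γ := sub_pos.2 hγ
  have hiff : ENNReal.ofReal r ≤ t ↔ r ≤ t :=
    ENNReal.ofReal_le_iff_le_toReal ENNReal.coe_ne_top
  by_cases hrt : r ≤ t
  · rw [indicator_of_mem (mem_Ioc.2 ⟨hr, hrt⟩), cutPower, if_pos (hiff.2 hrt), radialGrowth,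
      ENNReal.toReal_ofReal hr.le, ← ENNReal.ofReal_div_of_pos hr,
      ENNReal.ofReal_rpow_of_pos (div_pos hs hr), ← ENNReal.ofReal_mul (by positivity),
      ← ENNReal.ofReal_mul hr.le, ← ENNReal.ofReal_mul (by positivity)]
    field_simp
  · rw [indicator_of_notMem (fun h => hrt h.2), cutPower, if_neg (mt hiff.1 hrt), zero_mul,
      mul_zero]

lemma lintegral_cutPower_mul_radialGrowth_le {lam s γ : ℝ} (hlam : 0 < lam) (hs : 0 < s)
    (hγ : γ < 2) {t : ℝ≥0∞} (ht : t ≠ ⊤) :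
    ∫⁻ u : ℂ, cutPower (ENNReal.ofReal s) γ t ‖u‖ₑ * radialGrowth lam s γ ‖u‖ₑ ≤
      ENNReal.ofReal (2 * Real.pi * s ^ 2 / ((2 - γ) * lam)) * radialGrowth lam s γ t := by
  have hγ' : 0 < 2 - γ := sub_pos.2 hγ
  lift t to NNReal using ht
  set F : ℝ → ℝ := fun r => Real.exp (lam * (r / s) ^ (2 - γ))
  have hFTC : ∫⁻ r in Ioc 0 (t : ℝ), ENNReal.ofReal
      ((2 - γ) * lam / s ^ 2 * (r * ((s / r) ^ γ * F r))) = ENNReal.ofReal (F t - F 0) := by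
    refine lintegral_Ioc_deriv_eq_sub t.2 (Continuous.continuousOn ?_)
      (fun r hr => hasDerivAt_exp_mul_div_rpow hs hr.1) fun r hr => ?_
    · exact Real.continuous_exp.comp (((continuous_id.div_const s).rpow_const
        fun _ => Or.inr hγ'.le).const_mul lam)
    · have hr0 : 0 < r := hr.1
      simp only [F]
      positivity
  simp_rw [← ofReal_norm]
  rw [lintegral_comp_norm_complex (g := fun r => cutPower (ENNReal.ofReal s) γ t
      (ENNReal.ofReal r) * radialGrowth lam s γ (ENNReal.ofReal r)) (by fun_prop),
    setLIntegral_congr_fun measurableSet_Ioi fun r hr =>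
      ofReal_mul_cutPower_mul_radialGrowth hlam hs hγ t hr,
    lintegral_indicator measurableSet_Ioc, Measure.restrict_restrict measurableSet_Ioc,
    inter_eq_left.2 Ioc_subset_Ioi_self, lintegral_const_mul _ (by fun_prop), hFTC, ← mul_assoc,
    ← ENNReal.ofReal_mul (by positivity), ← mul_div_assoc, radialGrowth, ENNReal.coe_toReal]
  gcongr
  exact sub_le_self _ (Real.exp_pos _).le

lemma lintegral_cutPower_le {s γ : ℝ} (hs : 0 < s) (hγ : γ < 2) :
    ∫⁻ u : ℂ, cutPower (ENNReal.ofReal s) γ (ENNReal.ofReal s) ‖u‖ₑ ≤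
      ENNReal.ofReal (2 * Real.pi * Real.exp 1 / (2 - γ) * s ^ 2) := by
  have hγ' : 0 < 2 - γ := sub_pos.2 hγ
  calc _ ≤ ∫⁻ u : ℂ, cutPower (ENNReal.ofReal s) γ (ENNReal.ofReal s) ‖u‖ₑ *
        radialGrowth 1 s γ ‖u‖ₑ :=
        lintegral_mono fun u => le_mul_of_one_le_right'
          (one_le_radialGrowth zero_le_one hs.le γ _)
    _ ≤ _ := lintegral_cutPower_mul_radialGrowth_le one_pos hs hγ ENNReal.ofReal_ne_top
    _ = _ := by
        rw [radialGrowth_self hs, ← ENNReal.ofReal_mul (by positivity)]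
        ring_nf

lemma le_cutPower_add_one (s : ℝ≥0∞) {γ : ℝ} (hγ : 0 ≤ γ) (d : ℝ≥0∞) :
    (s / d) ^ γ ≤ cutPower s γ s d + 1 := by
  rw [cutPower]
  split_ifs with hd
  · exact le_self_add
  · rw [zero_add]
    exact ENNReal.rpow_le_one
      (ENNReal.div_le_of_le_mul (by rw [one_mul]; exact (not_le.1 hd).le)) hγ

/-- The constant in the integrals of `(s / |y - q|) ^ γ` over discs of radius `s`. -/
noncomputable def discConst (γ : ℝ) : ℝ := 2 * Real.pi * Real.exp 1 / (2 - γ) + Real.pi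

lemma setLIntegral_closedBall_div_rpow_le {s γ : ℝ} (hs : 0 < s) (hγ0 : 0 ≤ γ) (hγ : γ < 2)
    (p q : ℂ) : ∫⁻ y in Metric.closedBall p s, (ENNReal.ofReal s / edist y q) ^ γ ≤
      ENNReal.ofReal (discConst γ * s ^ 2) := by
  have hγ' : 0 < 2 - γ := sub_pos.2 hγ
  calc _ ≤ ∫⁻ y in Metric.closedBall p s,
        (cutPower (ENNReal.ofReal s) γ (ENNReal.ofReal s) (edist y q) + 1) :=
        lintegral_mono fun y => le_cutPower_add_one _ hγ0 _
    _ = (∫⁻ y in Metric.closedBall p s,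
          cutPower (ENNReal.ofReal s) γ (ENNReal.ofReal s) (edist y q)) +
          volume (Metric.closedBall p s) := by
        rw [lintegral_add_right _ measurable_const, setLIntegral_one]
    _ ≤ (∫⁻ y : ℂ, cutPower (ENNReal.ofReal s) γ (ENNReal.ofReal s) ‖y - q‖ₑ) +
          volume (Metric.closedBall p s) := by
        simp only [← edist_eq_enorm_sub]
        exact add_le_add_left (setLIntegral_le_lintegral _ _) _
    _ ≤ ENNReal.ofReal (2 * Real.pi * Real.exp 1 / (2 - γ) * s ^ 2) +
          ENNReal.ofReal (Real.pi * s ^ 2) := by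
        rw [lintegral_sub_right_eq_self
          (fun u : ℂ => cutPower (ENNReal.ofReal s) γ (ENNReal.ofReal s) ‖u‖ₑ) q]
        refine add_le_add (lintegral_cutPower_le hs hγ) (le_of_eq ?_)
        rw [Complex.volume_closedBall, ENNReal.ofReal_mul Real.pi_pos.le, mul_comm,
          ENNReal.ofReal_pow hs.le, ← NNReal.coe_real_pi, ENNReal.ofReal_coe_nnreal]
    _ = _ := by
        rw [← ENNReal.ofReal_add (by positivity) (by positivity), discConst, add_mul]

/-- The singular factor at a pair of fixed points at distance `d`. -/
noncomputable def pairFactor (γ : ℝ) (d : ℝ≥0∞) : ℝ≥0∞ := 1 + (1 / d) ^ γ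

@[fun_prop]
lemma measurable_pairFactor (γ : ℝ) : Measurable (pairFactor γ) := by
  unfold pairFactor
  fun_prop

lemma one_le_pairFactor (γ : ℝ) (d : ℝ≥0∞) : 1 ≤ pairFactor γ d := le_self_add

lemma pairFactor_one (γ : ℝ) : pairFactor γ 1 = 2 := by
  rw [pairFactor, div_one, ENNReal.one_rpow, one_add_one_eq_two]

lemma div_rpow_eq_mul_one_div_rpow {γ : ℝ} (hγ0 : 0 ≤ γ) (s a : ℝ≥0∞) :
    (s / a) ^ γ = s ^ γ * (1 / a) ^ γ := by
  rw [← ENNReal.mul_rpow_of_nonneg _ _ hγ0, mul_one_div]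

lemma one_div_rpow_le_of_le_two_mul {γ : ℝ} (hγ0 : 0 ≤ γ) (hγ : γ ≤ 2) {a d : ℝ≥0∞}
    (h : d ≤ 2 * a) : (1 / a) ^ γ ≤ 4 * (1 / d) ^ γ := by
  have hd : d / 2 ≤ a := ENNReal.div_le_of_le_mul (by rwa [mul_comm])
  calc (1 / a) ^ γ ≤ (1 / (d / 2)) ^ γ :=
        ENNReal.rpow_le_rpow (ENNReal.div_le_div_left hd _) hγ0
    _ = 2 ^ γ * (1 / d) ^ γ := by
        rw [one_div, ENNReal.inv_div (Or.inl ENNReal.ofNat_ne_top) (Or.inl two_ne_zero),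
          div_rpow_eq_mul_one_div_rpow hγ0]
    _ ≤ 2 ^ (2 : ℝ) * (1 / d) ^ γ := by
        gcongr
        exact one_le_two
    _ = 4 * (1 / d) ^ γ := by norm_num

lemma div_rpow_mul_one_div_rpow_le {γ : ℝ} (hγ0 : 0 ≤ γ) (hγ : γ ≤ 2) (s : ℝ≥0∞) {a b d : ℝ≥0∞}
    (h : d ≤ a + b) :
    (s / a) ^ γ * (1 / b) ^ γ ≤ 4 * (1 / d) ^ γ * ((s / a) ^ γ + (s / b) ^ γ) := by
  rcases le_total a b with hab | hab
  · have hd : d ≤ 2 * b := h.trans (by rw [two_mul]; gcongr)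
    rw [mul_comm]
    exact mul_le_mul' (one_div_rpow_le_of_le_two_mul hγ0 hγ hd) le_self_add
  · have hd : d ≤ 2 * a := h.trans (by rw [two_mul]; gcongr)
    calc (s / a) ^ γ * (1 / b) ^ γ = (1 / a) ^ γ * (s / b) ^ γ := by
          rw [div_rpow_eq_mul_one_div_rpow hγ0 s a, div_rpow_eq_mul_one_div_rpow hγ0 s b]
          ring
      _ ≤ _ := mul_le_mul' (one_div_rpow_le_of_le_two_mul hγ0 hγ hd) le_add_self

lemma cutPower_edist {s γ : ℝ} (hs : 0 ≤ s) (p y : ℂ) :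
    cutPower (ENNReal.ofReal s) γ (ENNReal.ofReal s) (edist p y) =
      (Metric.closedBall p s).indicator (fun y => (ENNReal.ofReal s / edist y p) ^ γ) y := by
  rw [edist_comm]
  have hiff : edist y p ≤ ENNReal.ofReal s ↔ y ∈ Metric.closedBall p s := by
    rw [Metric.mem_closedBall, edist_dist, ENNReal.ofReal_le_ofReal_iff hs]
  by_cases hy : y ∈ Metric.closedBall p s
  · rw [cutPower, if_pos (hiff.2 hy), indicator_of_mem hy]
  · rw [cutPower, if_neg (mt hiff.1 hy), indicator_of_notMem hy]

lemma lintegral_cutPower_mul_pairFactor_le {s γ : ℝ} (hs : 0 < s) (hγ0 : 0 ≤ γ) (hγ : γ < 2)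
    (p q : ℂ) :
    ∫⁻ y : ℂ, cutPower (ENNReal.ofReal s) γ (ENNReal.ofReal s) (edist p y) *
        pairFactor γ (edist y q) ≤
      8 * ENNReal.ofReal (discConst γ * s ^ 2) * pairFactor γ (edist p q) := by
  set S := ENNReal.ofReal s
  set B := Metric.closedBall p s
  set J := ENNReal.ofReal (discConst γ * s ^ 2)
  set Q := (1 / edist p q) ^ γ
  have hJ : ∀ z, ∫⁻ y in B, (S / edist y z) ^ γ ≤ J :=
    setLIntegral_closedBall_div_rpow_le hs hγ0 hγ p
  calc ∫⁻ y : ℂ, cutPower S γ S (edist p y) * pairFactor γ (edist y q)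
      = ∫⁻ y in B, (S / edist y p) ^ γ * pairFactor γ (edist y q) := by
        rw [← lintegral_indicator Metric.isClosed_closedBall.measurableSet]
        refine lintegral_congr fun y => ?_
        rw [cutPower_edist hs.le]
        exact (indicator_mul_left B (fun y => (S / edist y p) ^ γ)
          fun y => pairFactor γ (edist y q)).symm
    _ ≤ ∫⁻ y in B, ((S / edist y p) ^ γ +
          4 * Q * ((S / edist y p) ^ γ + (S / edist y q) ^ γ)) := by
        refine lintegral_mono fun y => ?_
        rw [pairFactor, mul_add, mul_one]
        refine add_le_add le_rfl ?_
        exact div_rpow_mul_one_div_rpow_le hγ0 hγ.le S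
          (edist_comm y p ▸ edist_triangle p y q)
    _ = (∫⁻ y in B, (S / edist y p) ^ γ) +
          4 * Q * ((∫⁻ y in B, (S / edist y p) ^ γ) + ∫⁻ y in B, (S / edist y q) ^ γ) := by
        rw [lintegral_add_left (by fun_prop), lintegral_const_mul _ (by fun_prop),
          lintegral_add_left (by fun_prop)]
    _ ≤ J + 4 * Q * (J + J) := by gcongr <;> exact hJ _
    _ = J + 8 * J * Q := by ring
    _ ≤ 8 * J + 8 * J * Q := by
        gcongr
        exact le_mul_of_one_le_left' (by norm_num)
    _ = 8 * J * pairFactor γ (edist p q) := by rw [pairFactor]; ring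

end PlanarIntegrals

section Marginals

variable {ι : Type*} [DecidableEq ι] {X : ι → Type*} [∀ i, MeasurableSpace (X i)]
  {μ : ∀ i, Measure (X i)} {T : Finset ι}

lemma lmarginal_const_mul {f : (∀ i, X i) → ℝ≥0∞} (hf : Measurable f) (c : ℝ≥0∞) (x : ∀ i, X i) :
    lmarginal μ T (fun x => c * f x) x = c * lmarginal μ T f x :=
  lintegral_const_mul _ (hf.comp measurable_updateFinset)

lemma lmarginal_add {f g : (∀ i, X i) → ℝ≥0∞} (hf : Measurable f) (x : ∀ i, X i) :
    lmarginal μ T (fun x => f x + g x) x = lmarginal μ T f x + lmarginal μ T g x :=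
  lintegral_add_left (hf.comp measurable_updateFinset) _

lemma lmarginal_finset_sum {κ : Type*} (A : Finset κ) {f : κ → (∀ i, X i) → ℝ≥0∞}
    (hf : ∀ k ∈ A, Measurable (f k)) (x : ∀ i, X i) :
    lmarginal μ T (fun x => ∑ k ∈ A, f k x) x = ∑ k ∈ A, lmarginal μ T (f k) x :=
  lintegral_finsetSum _ fun k hk => (hf k hk).comp measurable_updateFinset

lemma lmarginal_one_le [∀ i, SigmaFinite (μ i)] {W : ℝ≥0∞} (hW : ∀ i, μ i Set.univ ≤ W)
    (x : ∀ i, X i) : lmarginal μ T (fun _ => 1) x ≤ W ^ T.card := by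
  rw [lmarginal, lintegral_one, Measure.pi_univ]
  simpa only [Finset.card_univ, Fintype.card_coe] using
    Finset.prod_le_pow_card Finset.univ (fun i : T => μ i Set.univ) W fun i _ => hW i

lemma lmarginal_update_of_indep {f : (∀ i, X i) → ℝ≥0∞} {p : ι}
    (hf : ∀ x y, (∀ i ≠ p, x i = y i) → f x = f y) (x : ∀ i, X i) (z : X p) :
    lmarginal μ T f (Function.update x p z) = lmarginal μ T f x := by
  refine lintegral_congr fun y => hf _ _ fun i hi => ?_
  rw [Function.updateFinset, Function.updateFinset, Function.update_of_ne hi]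

lemma lmarginal_eq_of_notMem {Y : Type*} {g : (∀ i, X i) → Y}
    (hg : ∀ x y, (∀ i ∉ T, x i = y i) → g x = g y) (F : Y → (∀ i, X i) → ℝ≥0∞) (x : ∀ i, X i) :
    lmarginal μ T (fun x => F (g x) x) x = lmarginal μ T (F (g x)) x := by
  refine lintegral_congr fun y => ?_
  simp only [hg (Function.updateFinset x T y) x fun _ hi => dif_neg hi]

variable {E : Type*} [NormedAddCommGroup E] [MeasurableSpace E] [BorelSpace E]
  [SecondCountableTopology E] {ν ρ : Measure E} [SigmaFinite ν] [SigmaFinite ρ]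
  [ρ.IsAddRightInvariant]

/-- The coordinate `x i` is integrated out as `x i - x j`. -/
lemma lmarginal_shift_le (hν : ν ≤ ρ) {i j : ι} (hi : i ∈ T) (hij : j ≠ i)
    {F : ℝ≥0∞ → (ι → E) → ℝ≥0∞} (hF : Measurable fun z : ℝ≥0∞ × (ι → E) => F z.1 z.2)
    (hFi : ∀ a x y, (∀ l ≠ i, x l = y l) → F a x = F a y) (x : ι → E) :
    lmarginal (fun _ => ν) T (fun x => F (edist (x i) (x j)) x) x ≤
      ∫⁻ u, lmarginal (fun _ => ν) (T.erase i) (F ‖u‖ₑ) x ∂ρ := by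
  have hFm : Measurable fun x : ι → E => F (edist (x i) (x j)) x :=
    hF.comp (((measurable_pi_apply i).edist (measurable_pi_apply j)).prodMk measurable_id)
  have shift : ∀ x : ι → E, ∫⁻ y, F (edist (Function.update x i y i) (Function.update x i y j))
      (Function.update x i y) ∂ν ≤ ∫⁻ u, F ‖u‖ₑ x ∂ρ := fun x => by
    rw [← lintegral_sub_right_eq_self (fun u => F ‖u‖ₑ x) (x j)]
    refine (lintegral_mono' hν le_rfl).trans_eq (lintegral_congr fun y => ?_)
    rw [Function.update_self, Function.update_of_ne hij, edist_eq_enorm_sub]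
    exact hFi _ _ _ fun l hl => Function.update_of_ne hl _ _
  rw [lmarginal_erase' _ hFm hi]
  refine (lmarginal_mono shift x).trans_eq ?_
  simp only [lmarginal]
  refine lintegral_lintegral_swap (Measurable.aemeasurable ?_)
  exact hF.comp ((measurable_enorm.comp measurable_snd).prodMk
    (measurable_updateFinset.comp measurable_fst))

end Marginals

section Recursion

variable {ι E : Type*} [DecidableEq ι]

lemma nearestWeight_congr [PseudoEMetricSpace E] {s : ℝ≥0∞} {β : ℝ} {A : Finset ι} {t : ℝ≥0∞}
    {x y : ι → E} (h : ∀ i ∈ A, x i = y i) : nearestWeight s β A t x = nearestWeight s β A t y := by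
  have hD : ∀ i ∈ A, nearestDist A x i = nearestDist A y i := fun i hi =>
    biInf_congr fun j hj => by rw [h i hi, h j (Finset.mem_of_mem_erase hj)]
  exact Finset.prod_congr rfl fun i hi => by rw [hD i hi]

@[fun_prop]
lemma measurable_nearestDist [PseudoEMetricSpace E] [MeasurableSpace E] [OpensMeasurableSpace E]
    [SecondCountableTopology E] (A : Finset ι) (i : ι) :
    Measurable fun x : ι → E => nearestDist A x i :=
  Measurable.biInf (A.erase i : Set ι) (Finset.countable_toSet _) fun j _ =>
    (measurable_pi_apply i).edist (measurable_pi_apply j)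

lemma measurable_nearestWeight [PseudoEMetricSpace E] [MeasurableSpace E] [OpensMeasurableSpace E]
    [SecondCountableTopology E] (s : ℝ≥0∞) (β : ℝ) (A : Finset ι) :
    Measurable fun z : ℝ≥0∞ × (ι → E) => nearestWeight s β A z.1 z.2 :=
  Finset.measurable_fun_prod _ fun i _ => measurable_cutPower measurable_fst
    ((measurable_nearestDist A i).comp measurable_snd) s β

lemma measurable_nearestWeight_right [PseudoEMetricSpace E] [MeasurableSpace E]
    [OpensMeasurableSpace E] [SecondCountableTopology E] (s : ℝ≥0∞) (β : ℝ) (A : Finset ι)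
    (t : ℝ≥0∞) : Measurable fun x : ι → E => nearestWeight s β A t x :=
  Finset.measurable_fun_prod _ fun i _ =>
    measurable_cutPower measurable_const (measurable_nearestDist A i) s β

variable {ν : Measure ℂ} {s β lam : ℝ} {b : ℝ≥0∞} {A : Finset ι}

/-- The bound propagated by the recursion on the index set `A`: the variables in `T` are integrated
out, and those with index `p`, `q` are the only other ones on which the weight may depend. -/
def MarginalBound (ν : Measure ℂ) (s β lam : ℝ) (b : ℝ≥0∞) (A : Finset ι) : Prop :=
  ∀ p q : ι, p ≠ q → ∀ T : Finset ι, p ∉ T → q ∉ T → A ⊆ insert p (insert q T) →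
    ∀ t ≤ ENNReal.ofReal s, ∀ x : ι → ℂ,
      lmarginal (fun _ => ν) T (nearestWeight (ENNReal.ofReal s) β A t) x ≤
        b * max 1 (ν Set.univ) ^ T.card * radialGrowth lam s (2 * β) t *
          pairFactor (2 * β) (edist (x p) (x q))

lemma MarginalBound.mono {b' : ℝ≥0∞} (h : MarginalBound ν s β lam b A) (hb : b ≤ b') :
    MarginalBound ν s β lam b' A := fun p q hpq T hp hq hA t ht x =>
  (h p q hpq T hp hq hA t ht x).trans (by gcongr)

lemma marginalBound_empty [SigmaFinite ν] (hs : 0 ≤ s) (hlam : 0 ≤ lam) :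
    MarginalBound ν s β lam 1 (∅ : Finset ι) := by
  intro p q _ T _ _ _ t _ x
  calc lmarginal (fun _ => ν) T (fun _ => 1) x ≤ max 1 (ν Set.univ) ^ T.card :=
        lmarginal_one_le (fun _ => le_max_right _ _) x
    _ ≤ 1 * max 1 (ν Set.univ) ^ T.card * radialGrowth lam s (2 * β) t := by
        rw [one_mul]
        exact le_mul_of_one_le_right' (one_le_radialGrowth hlam hs _ t)
    _ ≤ _ := le_mul_of_one_le_right' (one_le_pairFactor _ _)

/-- The weight left by a pair of points at distance `a` after one or both of them have been removed
from the configuration, the others being indexed by `A`. -/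
noncomputable def pairWeight (s β : ℝ) (t : ℝ≥0∞) (A : Finset ι) (a : ℝ≥0∞) (x : ι → ℂ) : ℝ≥0∞ :=
  cutPower (ENNReal.ofReal s) (2 * β) t a * nearestWeight (ENNReal.ofReal s) β A a x

lemma measurable_pairWeight (s β : ℝ) (t : ℝ≥0∞) (A : Finset ι) :
    Measurable fun z : ℝ≥0∞ × (ι → ℂ) => pairWeight s β t A z.1 z.2 := by
  have hweight := measurable_nearestWeight (E := ℂ) (ENNReal.ofReal s) β A
  have hcut : Measurable fun a => cutPower (ENNReal.ofReal s) (2 * β) t a := by fun_prop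
  exact (hcut.comp measurable_fst).mul hweight

lemma measurable_pairWeight_edist (s β : ℝ) (t : ℝ≥0∞) (A : Finset ι) (i j : ι) :
    Measurable fun x : ι → ℂ => pairWeight s β t A (edist (x i) (x j)) x :=
  (measurable_pairWeight s β t A).comp
    (((measurable_pi_apply i).edist (measurable_pi_apply j)).prodMk measurable_id)

lemma pairWeight_congr {t a : ℝ≥0∞} {x y : ι → ℂ} (h : ∀ i ∈ A, x i = y i) :
    pairWeight s β t A a x = pairWeight s β t A a y := by
  rw [pairWeight, nearestWeight_congr h, pairWeight]

variable {p q : ι} {T : Finset ι} {t : ℝ≥0∞}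

lemma MarginalBound.lmarginal_pairWeight_const_le (h : MarginalBound ν s β lam b A) (hpq : p ≠ q)
    (hp : p ∉ T) (hq : q ∉ T) (hA : A ⊆ insert p (insert q T)) (ht : t ≤ ENNReal.ofReal s)
    (a : ℝ≥0∞) (x : ι → ℂ) :
    lmarginal (fun _ => ν) T (pairWeight s β t A a) x ≤
      cutPower (ENNReal.ofReal s) (2 * β) t a * radialGrowth lam s (2 * β) a *
        (b * max 1 (ν Set.univ) ^ T.card * pairFactor (2 * β) (edist (x p) (x q))) := by
  calc _ = cutPower (ENNReal.ofReal s) (2 * β) t a *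
        lmarginal (fun _ => ν) T (nearestWeight (ENNReal.ofReal s) β A a) x :=
        lmarginal_const_mul (measurable_nearestWeight_right _ β A a) _ x
    _ ≤ cutPower (ENNReal.ofReal s) (2 * β) t a *
        (b * max 1 (ν Set.univ) ^ T.card * radialGrowth lam s (2 * β) a *
          pairFactor (2 * β) (edist (x p) (x q))) := by
        rw [cutPower]
        split_ifs with ha
        · gcongr
          exact h p q hpq T hp hq hA a (ha.trans ht) x
        · rw [zero_mul]
          exact zero_le
    _ = _ := by ring

lemma cutPower_mul_radialGrowth_le {γ : ℝ} (hs : 0 ≤ s) (hγ : γ ≤ 2) (hlam : 0 ≤ lam)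
    (ht : t ≤ ENNReal.ofReal s) (a : ℝ≥0∞) :
    cutPower (ENNReal.ofReal s) γ t a * radialGrowth lam s γ a ≤
      cutPower (ENNReal.ofReal s) γ (ENNReal.ofReal s) a * radialGrowth lam s γ t := by
  by_cases ha : a ≤ t
  · rw [cutPower, if_pos ha, cutPower, if_pos (ha.trans ht)]
    gcongr
    exact radialGrowth_mono hlam hs hγ ha (ne_top_of_le_ne_top ENNReal.ofReal_ne_top ht)
  · rw [cutPower, if_neg ha, zero_mul]
    exact zero_le

lemma cutPower_le_pairFactor {S : ℝ≥0∞} {γ : ℝ} (hS : S ≤ 1) (hγ : 0 ≤ γ) (a : ℝ≥0∞) :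
    cutPower S γ t a ≤ pairFactor γ a :=
  calc cutPower S γ t a ≤ (S / a) ^ γ := cutPower_le S γ t a
    _ ≤ (1 / a) ^ γ := by gcongr
    _ ≤ pairFactor γ a := le_add_self

/-- As the weight does not depend on `x p`, this point may be moved to distance `1` from `x q`. -/
lemma lmarginal_pairWeight_fixed_le (hs : 0 ≤ s) (hs1 : s ≤ 1) (hβ : 0 ≤ β) (hβ1 : β ≤ 1)
    (hlam : 0 ≤ lam) (h : MarginalBound ν s β lam b A) (hpq : p ≠ q) (hp : p ∉ T) (hq : q ∉ T)
    (hA : A ⊆ insert p (insert q T)) (hpA : p ∉ A) (ht : t ≤ ENNReal.ofReal s) (x : ι → ℂ) :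
    lmarginal (fun _ => ν) T (fun x => pairWeight s β t A (edist (x p) (x q)) x) x ≤
      2 * (b * max 1 (ν Set.univ) ^ T.card * radialGrowth lam s (2 * β) t *
          pairFactor (2 * β) (edist (x p) (x q))) := by
  set a := edist (x p) (x q)
  have hmoved := h.lmarginal_pairWeight_const_le hpq hp hq hA ht a (Function.update x p (x q + 1))
  rw [Function.update_self, Function.update_of_ne hpq.symm, edist_eq_enorm_sub (x q + 1),
    add_sub_cancel_left, enorm_one, pairFactor_one] at hmoved
  calc _ = lmarginal (fun _ => ν) T (pairWeight s β t A a) x :=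
        lmarginal_eq_of_notMem (g := fun x : ι → ℂ => edist (x p) (x q))
          (fun x y hxy => by rw [hxy p hp, hxy q hq]) (pairWeight s β t A) x
    _ = lmarginal (fun _ => ν) T (pairWeight s β t A a) (Function.update x p (x q + 1)) :=
        (lmarginal_update_of_indep (p := p) (fun x y hxy => pairWeight_congr fun l hl =>
          hxy l fun hlp => hpA (hlp ▸ hl)) x _).symm
    _ ≤ pairFactor (2 * β) a * radialGrowth lam s (2 * β) t *
          (b * max 1 (ν Set.univ) ^ T.card * 2) :=
        hmoved.trans (mul_le_mul_left ((cutPower_mul_radialGrowth_le hs (by linarith) hlam ht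
          a).trans (mul_le_mul_left (cutPower_le_pairFactor (ENNReal.ofReal_le_one.2 hs1)
            (by linarith) a) _)) _)
    _ = _ := by ring

lemma MarginalBound.lmarginal_erase_pairWeight_update_le (hs : 0 ≤ s) (hβ1 : β ≤ 1) (hlam : 0 ≤ lam)
    (h : MarginalBound ν s β lam b A) (hp : p ∉ T) (hq : q ∉ T) (hA : A ⊆ insert p (insert q T))
    (hpA : p ∉ A) {j : ι} (hj : j ∈ T) (ht : t ≤ ENNReal.ofReal s) (x : ι → ℂ) (y : ℂ) :
    lmarginal (fun _ => ν) (T.erase j) (fun x => pairWeight s β t A (edist (x p) (x j)) x)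
        (Function.update x j y) ≤
      cutPower (ENNReal.ofReal s) (2 * β) (ENNReal.ofReal s) (edist (x p) y) *
        pairFactor (2 * β) (edist y (x q)) *
        (b * max 1 (ν Set.univ) ^ T.card * radialGrowth lam s (2 * β) t) := by
  have hjp : p ≠ j := fun hpj => hp (hpj ▸ hj)
  have hjq : q ≠ j := fun hqj => hq (hqj ▸ hj)
  have hAj : A ⊆ insert j (insert q (T.erase j)) := fun l hl => by
    have hlp : l ≠ p := fun hlp => hpA (hlp ▸ hl)
    have := hA hl
    simp only [Finset.mem_insert, Finset.mem_erase] at this ⊢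
    tauto
  have h_pair := h.lmarginal_pairWeight_const_le hjq.symm (Finset.notMem_erase j T)
    (mt Finset.mem_of_mem_erase hq) hAj ht (edist (x p) y) (Function.update x j y)
  rw [Function.update_self, Function.update_of_ne hjq] at h_pair
  rw [lmarginal_eq_of_notMem (g := fun x : ι → ℂ => edist (x p) (x j)) (F := pairWeight s β t A)
    (fun x y hxy => by rw [hxy p (mt Finset.mem_of_mem_erase hp),
      hxy j (Finset.notMem_erase j T)]), Function.update_self, Function.update_of_ne hjp]
  calc _ ≤ _ := h_pair
    _ ≤ cutPower (ENNReal.ofReal s) (2 * β) (ENNReal.ofReal s) (edist (x p) y) *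
        radialGrowth lam s (2 * β) t *
        (b * max 1 (ν Set.univ) ^ T.card * pairFactor (2 * β) (edist y (x q))) := by
        refine mul_le_mul' (cutPower_mul_radialGrowth_le hs (by linarith) hlam ht _) ?_
        gcongr
        exacts [le_max_left _ _, Finset.erase_subset _ _]
    _ = _ := by ring

variable [SigmaFinite ν]

lemma lmarginal_pairWeight_free_le (hν : ν ≤ volume) (hs : 0 < s) (hβ1 : β < 1) (hlam : 0 < lam)
    (h : MarginalBound ν s β lam b A) (hpq : p ≠ q) (hp : p ∉ T) (hq : q ∉ T)
    (hA : A ⊆ insert p (insert q T)) {i j : ι} (hiA : i ∉ A) (hiT : i ∈ T) (hij : j ≠ i)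
    (ht : t ≤ ENNReal.ofReal s) (x : ι → ℂ) :
    lmarginal (fun _ => ν) T (fun x => pairWeight s β t A (edist (x i) (x j)) x) x ≤
      ENNReal.ofReal (2 * Real.pi * s ^ 2 / ((2 - 2 * β) * lam)) *
        (b * max 1 (ν Set.univ) ^ T.card * radialGrowth lam s (2 * β) t *
          pairFactor (2 * β) (edist (x p) (x q))) := by
  set P := pairFactor (2 * β) (edist (x p) (x q))
  have hAi : A ⊆ insert p (insert q (T.erase i)) := fun l hl => by
    have hli : l ≠ i := fun hli => hiA (hli ▸ hl)
    simpa only [Finset.mem_insert, Finset.mem_erase, hli, ne_eq, not_false_eq_true, true_and]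
      using hA hl
  calc _ ≤ ∫⁻ u : ℂ, lmarginal (fun _ => ν) (T.erase i) (pairWeight s β t A ‖u‖ₑ) x :=
        lmarginal_shift_le hν hiT hij (measurable_pairWeight s β t A)
          (fun _ _ _ hxy => pairWeight_congr fun l hl => hxy l fun hli => hiA (hli ▸ hl)) x
    _ ≤ ∫⁻ u : ℂ, cutPower (ENNReal.ofReal s) (2 * β) t ‖u‖ₑ * radialGrowth lam s (2 * β) ‖u‖ₑ *
          (b * max 1 (ν Set.univ) ^ (T.erase i).card * P) :=
        lintegral_mono fun u => h.lmarginal_pairWeight_const_le hpq (mt Finset.mem_of_mem_erase hp)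
          (mt Finset.mem_of_mem_erase hq) hAi ht _ x
    _ ≤ ENNReal.ofReal (2 * Real.pi * s ^ 2 / ((2 - 2 * β) * lam)) *
          radialGrowth lam s (2 * β) t * (b * max 1 (ν Set.univ) ^ T.card * P) := by
        rw [lintegral_mul_const _ (by fun_prop)]
        gcongr
        · exact lintegral_cutPower_mul_radialGrowth_le hlam hs (by linarith)
            (ne_top_of_le_ne_top ENNReal.ofReal_ne_top ht)
        · exact le_max_left _ _
        · exact Finset.erase_subset _ _
    _ = _ := by ring

lemma lmarginal_pairWeight_fixed_free_le (hν : ν ≤ volume) (hs : 0 < s) (hβ : 0 ≤ β) (hβ1 : β < 1)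
    (hlam : 0 ≤ lam) (h : MarginalBound ν s β lam b A) (hp : p ∉ T) (hq : q ∉ T)
    (hA : A ⊆ insert p (insert q T)) (hpA : p ∉ A) {j : ι} (hj : j ∈ T)
    (ht : t ≤ ENNReal.ofReal s) (x : ι → ℂ) :
    lmarginal (fun _ => ν) T (fun x => pairWeight s β t A (edist (x p) (x j)) x) x ≤
      8 * ENNReal.ofReal (discConst (2 * β) * s ^ 2) *
        (b * max 1 (ν Set.univ) ^ T.card * radialGrowth lam s (2 * β) t *
          pairFactor (2 * β) (edist (x p) (x q))) := by
  set S := ENNReal.ofReal s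
  set c := b * max 1 (ν Set.univ) ^ T.card * radialGrowth lam s (2 * β) t
  calc _ = ∫⁻ y, lmarginal (fun _ => ν) (T.erase j)
        (fun x => pairWeight s β t A (edist (x p) (x j)) x) (Function.update x j y) ∂ν :=
        lmarginal_erase _ (measurable_pairWeight_edist s β t A p j) hj x
    _ ≤ ∫⁻ y : ℂ, cutPower S (2 * β) S (edist (x p) y) * pairFactor (2 * β) (edist y (x q)) * c :=
        (lintegral_mono fun y => h.lmarginal_erase_pairWeight_update_le hs.le hβ1.le hlam hp hq hA
          hpA hj ht x y).trans (lintegral_mono' hν le_rfl)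
    _ ≤ 8 * ENNReal.ofReal (discConst (2 * β) * s ^ 2) *
          pairFactor (2 * β) (edist (x p) (x q)) * c := by
        rw [lintegral_mul_const _ (by fun_prop)]
        gcongr
        exact lintegral_cutPower_mul_pairFactor_le hs (by linarith) (by linarith) _ _
    _ = _ := by ring

end Recursion

section RecursionBound

variable {ι : Type*} {ν : Measure ℂ} {s β lam : ℝ} {b : ℝ≥0∞} {A : Finset ι}

lemma sum_indicator_pair_le (A : Finset ι) (p q : ι) :
    ∑ i ∈ A, Set.indicator {p, q} (1 : ι → ℝ≥0∞) i ≤ 2 := by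
  classical
  calc ∑ i ∈ A, Set.indicator {p, q} (1 : ι → ℝ≥0∞) i
      = ((A.filter (· ∈ ({p, q} : Set ι))).card : ℝ≥0∞) := by
        simp only [Set.indicator_apply, Pi.one_apply, Finset.sum_boole]
    _ ≤ (({p, q} : Finset ι).card : ℝ≥0∞) := by
        gcongr
        intro i hi
        simpa using (Finset.mem_filter.1 hi).2
    _ ≤ 2 := by exact_mod_cast Finset.card_le_two

/-- The factor by which the bound grows when the recursion adds a point to the configuration. -/
noncomputable def recursionConst (β : ℝ) : ℝ :=
  2 * (2 * Real.pi / (2 - 2 * β) + 16 * discConst (2 * β) + 8)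

lemma one_le_recursionConst (hβ1 : β < 1) : 1 ≤ recursionConst β := by
  have hβ2 : 0 < 2 - 2 * β := by linarith
  have hdisc : 0 ≤ discConst (2 * β) := by unfold discConst; positivity
  have hfree : 0 ≤ 2 * Real.pi / (2 - 2 * β) := by positivity
  unfold recursionConst
  linarith

lemma sum_pair_cost_le (hβ1 : β < 1) {n : ℕ} (hns : n * s ^ 2 = 1) (hA : A.card ≤ n) (p q : ι) :
    ∑ i ∈ A, ∑ j ∈ A, 2 * (ENNReal.ofReal (2 * Real.pi * s ^ 2 / ((2 - 2 * β) * n)) +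
        Set.indicator {p, q} 1 i *
          (8 * ENNReal.ofReal (discConst (2 * β) * s ^ 2) + Set.indicator {p, q} 1 j * 2)) ≤
      ENNReal.ofReal (recursionConst β) := by
  have hβ2 : 0 < 2 - 2 * β := by linarith
  have hdisc : 0 ≤ discConst (2 * β) := by unfold discConst; positivity
  have hn : (n : ℝ) ≠ 0 := fun hn => zero_ne_one (by rwa [hn, zero_mul] at hns)
  set e : ι → ℝ≥0∞ := Set.indicator {p, q} 1
  set D := 2 * Real.pi * s ^ 2 / ((2 - 2 * β) * n) with hD
  set D' := discConst (2 * β) * s ^ 2 with hD'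
  have he : ∑ i ∈ A, e i ≤ 2 := sum_indicator_pair_le A p q
  have hcard : (A.card : ℝ≥0∞) ≤ n := by exact_mod_cast hA
  calc _ = 2 * (A.card * (A.card * ENNReal.ofReal D) +
        (∑ i ∈ A, e i) * (A.card * (8 * ENNReal.ofReal D') + (∑ j ∈ A, e j) * 2)) := by
        simp only [Finset.sum_add_distrib, Finset.sum_const, nsmul_eq_mul, ← Finset.sum_mul,
          ← Finset.mul_sum]
    _ ≤ 2 * (n * (n * ENNReal.ofReal D) + 2 * (n * (8 * ENNReal.ofReal D') + 2 * 2)) := by gcongr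
    _ = ENNReal.ofReal (2 * (n * (n * D) + 2 * (n * (8 * D') + 2 * 2))) := by
        have hD0 : 0 ≤ D := by positivity
        have hD0' : 0 ≤ D' := by positivity
        clear_value D D'
        rw [ENNReal.ofReal_mul two_pos.le, ENNReal.ofReal_add (by positivity) (by positivity),
          ENNReal.ofReal_mul (by positivity), ENNReal.ofReal_mul (by positivity),
          ENNReal.ofReal_mul two_pos.le, ENNReal.ofReal_add (by positivity) (by positivity),
          ENNReal.ofReal_mul (by positivity), ENNReal.ofReal_mul (by positivity),
          ENNReal.ofReal_mul two_pos.le, ENNReal.ofReal_natCast]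
        simp only [ENNReal.ofReal_ofNat]
    _ = ENNReal.ofReal (recursionConst β) := by
        have hfree : n * (n * D) = 2 * Real.pi / (2 - 2 * β) := by
          rw [hD, ← mul_assoc, ← mul_div_assoc,
            show (n : ℝ) * n * (2 * Real.pi * s ^ 2) = n * (2 * Real.pi * (n * s ^ 2)) by ring,
            hns, mul_one, mul_comm (2 - 2 * β), mul_div_mul_left _ _ hn]
        have hterm : n * D' = discConst (2 * β) := by rw [hD', mul_left_comm, hns, mul_one]
        rw [hfree, mul_left_comm (n : ℝ), hterm, recursionConst]
        ring_nf

variable [DecidableEq ι]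

lemma lmarginal_nearestWeight_le_sum (hs : 0 < s) (hβ : 0 ≤ β) (hA : A.Nonempty) {t : ℝ≥0∞}
    (ht : t ≤ ENNReal.ofReal s) (T : Finset ι) (x : ι → ℂ) :
    lmarginal (fun _ => ν) T (nearestWeight (ENNReal.ofReal s) β A t) x ≤
      ∑ i ∈ A, ∑ j ∈ A.erase i,
        (lmarginal (fun _ => ν) T
            (fun x => pairWeight s β t (A.erase i) (edist (x i) (x j)) x) x +
          lmarginal (fun _ => ν) T
            (fun x => pairWeight s β t ((A.erase i).erase j) (edist (x i) (x j)) x) x) := by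
  have hmeas := measurable_pairWeight_edist (ι := ι) s β t
  have hadd : ∀ i j, Measurable fun x : ι → ℂ =>
      pairWeight s β t (A.erase i) (edist (x i) (x j)) x +
        pairWeight s β t ((A.erase i).erase j) (edist (x i) (x j)) x := fun i j =>
    (hmeas _ i j).add (hmeas _ i j)
  calc _ ≤ lmarginal (fun _ => ν) T (fun x => ∑ i ∈ A, ∑ j ∈ A.erase i,
        (pairWeight s β t (A.erase i) (edist (x i) (x j)) x +
          pairWeight s β t ((A.erase i).erase j) (edist (x i) (x j)) x)) x :=
        lmarginal_mono (fun x => (nearestWeight_le_sum (ENNReal.ofReal_pos.2 hs).ne'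
          ENNReal.ofReal_ne_top ht hβ hA x).trans_eq (by simp only [pairWeight, mul_add])) x
    _ = _ := by
        rw [lmarginal_finset_sum A fun i _ => Finset.measurable_fun_sum _ fun j _ => hadd i j]
        refine Finset.sum_congr rfl fun i _ => ?_
        rw [lmarginal_finset_sum (A.erase i) fun j _ => hadd i j]
        exact Finset.sum_congr rfl fun j _ => lmarginal_add (hmeas _ i j) x

variable [SigmaFinite ν]

lemma lmarginal_pairWeight_le (hν : ν ≤ volume) (hs : 0 < s) (hs1 : s ≤ 1) (hβ : 0 ≤ β)
    (hβ1 : β < 1) (hlam : 0 < lam) (h : MarginalBound ν s β lam b A) {p q : ι} (hpq : p ≠ q)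
    {T : Finset ι} (hp : p ∉ T) (hq : q ∉ T) (hA : A ⊆ insert p (insert q T)) {i j : ι}
    (hi : i ∈ insert p (insert q T)) (hj : j ∈ insert p (insert q T)) (hiA : i ∉ A) (hij : j ≠ i)
    {t : ℝ≥0∞} (ht : t ≤ ENNReal.ofReal s) (x : ι → ℂ) :
    lmarginal (fun _ => ν) T (fun x => pairWeight s β t A (edist (x i) (x j)) x) x ≤
      (ENNReal.ofReal (2 * Real.pi * s ^ 2 / ((2 - 2 * β) * lam)) + Set.indicator {p, q} 1 i *
          (8 * ENNReal.ofReal (discConst (2 * β) * s ^ 2) + Set.indicator {p, q} 1 j * 2)) *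
        (b * max 1 (ν Set.univ) ^ T.card * radialGrowth lam s (2 * β) t *
          pairFactor (2 * β) (edist (x p) (x q))) := by
  have at_terminal : ∀ p q : ι, p ≠ q → p ∉ T → q ∉ T → A ⊆ insert p (insert q T) → p ∉ A →
      j ≠ p → j ∈ insert p (insert q T) →
      lmarginal (fun _ => ν) T (fun x => pairWeight s β t A (edist (x p) (x j)) x) x ≤
        (8 * ENNReal.ofReal (discConst (2 * β) * s ^ 2) + Set.indicator {p, q} 1 j * 2) *
        (b * max 1 (ν Set.univ) ^ T.card * radialGrowth lam s (2 * β) t *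
          pairFactor (2 * β) (edist (x p) (x q))) := by
    intro p q hpq hp hq hA hpA hjp hj
    rcases Finset.mem_insert.1 (Finset.mem_of_mem_insert_of_ne hj hjp) with rfl | hjT
    · refine (lmarginal_pairWeight_fixed_le hs.le hs1 hβ hβ1.le hlam.le h hpq hp hq hA hpA ht
        x).trans (mul_le_mul_left ?_ _)
      rw [Set.indicator_of_mem (by simp), Pi.one_apply, one_mul]
      exact le_add_self
    · exact (lmarginal_pairWeight_fixed_free_le hν hs hβ hβ1 hlam.le h hp hq hA hpA hjT ht
        x).trans (mul_le_mul_left le_self_add _)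
  by_cases hiT : i ∈ T
  · exact (lmarginal_pairWeight_free_le hν hs hβ1 hlam h hpq hp hq hA hiA hiT hij ht
      x).trans (mul_le_mul_left le_self_add _)
  · have hipq : i = p ∨ i = q := by
      simpa only [Finset.mem_insert, hiT, or_false] using hi
    refine le_trans ?_ (mul_le_mul_left le_add_self _)
    rw [Set.indicator_of_mem (by simpa using hipq), Pi.one_apply, one_mul]
    rcases hipq with rfl | rfl
    · exact at_terminal i q hpq hp hq hA hiA hij hj
    · rw [Finset.insert_comm] at hA hj
      rw [Set.pair_comm, edist_comm (x p)]
      exact at_terminal i p hpq.symm hq hp hA hiA hij hj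

lemma MarginalBound.of_ssubset (hν : ν ≤ volume) (hs : 0 < s) (hs1 : s ≤ 1) (hβ : 0 ≤ β)
    (hβ1 : β < 1) {n : ℕ} (hns : n * s ^ 2 = 1) (hA : A.Nonempty) (hAn : A.card ≤ n)
    (h : ∀ A' ⊂ A, MarginalBound ν s β n b A') :
    MarginalBound ν s β n (ENNReal.ofReal (recursionConst β) * b) A := by
  intro p q hpq T hp hq hAT t ht x
  have hn : (0 : ℝ) < n := by exact_mod_cast hA.card_pos.trans_le hAn
  set Y := b * max 1 (ν Set.univ) ^ T.card * radialGrowth n s (2 * β) t *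
    pairFactor (2 * β) (edist (x p) (x q)) with hY
  set c : ι → ι → ℝ≥0∞ := fun i j =>
    ENNReal.ofReal (2 * Real.pi * s ^ 2 / ((2 - 2 * β) * n)) + Set.indicator {p, q} 1 i *
      (8 * ENNReal.ofReal (discConst (2 * β) * s ^ 2) + Set.indicator {p, q} 1 j * 2)
  have pair_le : ∀ i ∈ A, ∀ j ∈ A.erase i, ∀ A' ⊆ A.erase i,
      lmarginal (fun _ => ν) T (fun x => pairWeight s β t A' (edist (x i) (x j)) x) x ≤
        c i j * Y := fun i hi j hj A' hA' =>
    lmarginal_pairWeight_le hν hs hs1 hβ hβ1 hn (h A' (hA'.trans_ssubset (Finset.erase_ssubset hi)))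
      hpq hp hq ((hA'.trans (Finset.erase_subset i A)).trans hAT) (hAT hi)
      (hAT (Finset.mem_of_mem_erase hj)) (fun hiA' => Finset.notMem_erase i A (hA' hiA'))
      (Finset.ne_of_mem_erase hj) ht x
  calc _ ≤ ∑ i ∈ A, ∑ j ∈ A.erase i, (c i j * Y + c i j * Y) :=
        (lmarginal_nearestWeight_le_sum hs hβ hA ht T x).trans <|
          Finset.sum_le_sum fun i hi => Finset.sum_le_sum fun j hj =>
            add_le_add (pair_le i hi j hj _ subset_rfl)
              (pair_le i hi j hj _ (Finset.erase_subset _ _))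
    _ ≤ ∑ i ∈ A, ∑ j ∈ A, (c i j * Y + c i j * Y) :=
        Finset.sum_le_sum fun i _ => Finset.sum_le_sum_of_subset (Finset.erase_subset _ _)
    _ = (∑ i ∈ A, ∑ j ∈ A, 2 * c i j) * Y := by
        simp only [Finset.sum_mul, two_mul, add_mul]
    _ ≤ ENNReal.ofReal (recursionConst β) * Y := by
        gcongr
        exact sum_pair_cost_le hβ1 hns hAn p q
    _ = _ := by rw [hY]; ring

lemma marginalBound_pow (hν : ν ≤ volume) (hs : 0 < s) (hs1 : s ≤ 1) (hβ : 0 ≤ β) (hβ1 : β < 1)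
    {n : ℕ} (hns : n * s ^ 2 = 1) (hA : A.card ≤ n) :
    MarginalBound ν s β n (ENNReal.ofReal (recursionConst β) ^ A.card) A := by
  have hone : 1 ≤ ENNReal.ofReal (recursionConst β) :=
    ENNReal.one_le_ofReal.2 (one_le_recursionConst hβ1)
  induction A using Finset.strongInduction with
  | H A ih =>
    rcases A.eq_empty_or_nonempty with rfl | hne
    · simpa only [Finset.card_empty, pow_zero] using marginalBound_empty hs.le n.cast_nonneg
    · have hsub : ∀ A' ⊂ A, MarginalBound ν s β n
          (ENNReal.ofReal (recursionConst β) ^ (A.card - 1)) A' := fun A' hA' =>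
        have hlt := Finset.card_lt_card hA'
        (ih A' hA' (hlt.le.trans hA)).mono (pow_le_pow_right₀ hone (Nat.le_sub_one_of_lt hlt))
      rw [← Nat.sub_add_cancel hne.card_pos, pow_succ']
      exact MarginalBound.of_ssubset hν hs hs1 hβ hβ1 hns hne hA hsub

lemma lmarginal_prod_max_le [Fintype ι] (hν : ν ≤ volume) (hs : 0 < s) (hs1 : s ≤ 1) (hβ : 0 ≤ β)
    (hβ1 : β < 1) (hns : (Fintype.card ι : ℝ) * s ^ 2 = 1) {p q : ι} (hpq : p ≠ q) (x : ι → ℂ) :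
    lmarginal (fun _ => ν) (Finset.univ \ {p, q}) (fun x =>
        ∏ i, (max 1 (ENNReal.ofReal s / nearestDist Finset.univ x i)) ^ β) x ≤
      (2 * max 1 (ν Set.univ) * ENNReal.ofReal (recursionConst β) * ENNReal.ofReal (Real.exp 1)) ^
        Fintype.card ι * pairFactor (2 * β) (edist (x p) (x q)) := by
  set S := ENNReal.ofReal s
  set B := ENNReal.ofReal (recursionConst β)
  set N := Fintype.card ι
  set T : Finset ι := Finset.univ \ {p, q} with hT
  have hcover : ∀ A : Finset ι, A ⊆ insert p (insert q T) := fun A i _ => by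
    simp only [hT, Finset.mem_insert, Finset.mem_sdiff, Finset.mem_univ, Finset.mem_singleton]
    tauto
  have hgrowth : radialGrowth N s (2 * β) S = ENNReal.ofReal (Real.exp 1) ^ N := by
    rw [radialGrowth_self hs, ← ENNReal.ofReal_pow (Real.exp_pos 1).le, ← Real.exp_nat_mul, mul_one]
  have subset_le : ∀ A : Finset ι, lmarginal (fun _ => ν) T (nearestWeight S β A S) x ≤
      B ^ N * max 1 (ν Set.univ) ^ N * ENNReal.ofReal (Real.exp 1) ^ N *
        pairFactor (2 * β) (edist (x p) (x q)) := fun A =>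
    calc _ ≤ _ := marginalBound_pow hν hs hs1 hβ hβ1 hns (Finset.card_le_univ A) p q hpq T
          (by simp [hT]) (by simp [hT]) (hcover A) S le_rfl x
      _ ≤ _ := by
          rw [hgrowth]
          gcongr
          exacts [ENNReal.one_le_ofReal.2 (one_le_recursionConst hβ1), Finset.card_le_univ A,
            le_max_left _ _, Finset.card_le_univ T]
  calc _ ≤ lmarginal (fun _ => ν) T (fun x => ∑ A : Finset ι, nearestWeight S β A S x) x :=
        lmarginal_mono (fun x => prod_max_le_sum_nearestWeight (ENNReal.ofReal_pos.2 hs).ne'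
          ENNReal.ofReal_ne_top x) x
    _ = ∑ A : Finset ι, lmarginal (fun _ => ν) T (nearestWeight S β A S) x :=
        lmarginal_finset_sum _ (fun A _ => measurable_nearestWeight_right S β A S) x
    _ ≤ ∑ _A : Finset ι, B ^ N * max 1 (ν Set.univ) ^ N * ENNReal.ofReal (Real.exp 1) ^ N *
          pairFactor (2 * β) (edist (x p) (x q)) := Finset.sum_le_sum fun A _ => subset_le A
    _ = _ := by
        rw [Finset.sum_const, Finset.card_univ, Fintype.card_finset, nsmul_eq_mul, mul_pow,
          mul_pow, mul_pow]
        push_cast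
        ring

end RecursionBound

section Energy

section Divergence

variable {E : Type*} [NormedAddCommGroup E] [NormedSpace ℝ E]

lemma contDiff_indicator_of_eqOn_zero {F : Type*} [NormedAddCommGroup F] [NormedSpace ℝ F]
    {Ω K : Set E} {f : E → F} {m : WithTop ℕ∞} (hΩ : IsOpen Ω) (hK : IsCompact K) (hKΩ : K ⊆ Ω)
    (hf : ContDiffOn ℝ m f Ω) (h0 : ∀ x ∈ Ω, x ∉ K → f x = 0) : ContDiff ℝ m (Ω.indicator f) := by
  refine contDiff_iff_contDiffAt.2 fun x => ?_
  by_cases hx : x ∈ Ω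
  · exact (hf.contDiffAt (hΩ.mem_nhds hx)).congr_of_eventuallyEq
      (Filter.eventually_of_mem (hΩ.mem_nhds hx) fun y hy => Set.indicator_of_mem hy f)
  · refine contDiffAt_const (c := (0 : F)).congr_of_eventuallyEq (Filter.eventually_of_mem
      (hK.isClosed.isOpen_compl.mem_nhds fun hxK => hx (hKΩ hxK)) fun y hy => ?_)
    by_contra hne
    obtain ⟨hyΩ, hfy⟩ := Set.indicator_apply_ne_zero.1 hne
    exact hfy (h0 y hyΩ hy)

variable [FiniteDimensional ℝ E] [MeasurableSpace E] [BorelSpace E]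
  (μ : Measure E) [μ.IsAddHaarMeasure]

lemma integral_fderiv_apply_eq_zero {f : E → ℝ} (hf : ContDiff ℝ 1 f) (hc : HasCompactSupport f)
    (v : E) : ∫ x, fderiv ℝ f x v ∂μ = 0 := by
  have hderiv : Continuous fun x => fderiv ℝ f x v :=
    (hf.continuous_fderiv (by simp)).clm_apply continuous_const
  simpa using integral_mul_fderiv_eq_neg_fderiv_mul_of_integrable (μ := μ) (𝕜 := ℝ)
    (f := fun _ : E => (1 : ℝ)) (g := f) (v := v) (by simp)
    (by simpa using hderiv.integrable_of_hasCompactSupport (hc.fderiv_apply ℝ v))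
    (by simpa using hf.continuous.integrable_of_hasCompactSupport hc)
    (fun x _ => differentiableAt_const _) (fun x _ => hf.differentiable (by simp) x)

lemma integrableOn_and_setIntegral_fderiv_apply_eq_zero {Ω K : Set E} {f : E → ℝ}
    (hΩ : IsOpen Ω) (hK : IsCompact K) (hKΩ : K ⊆ Ω) (hf : ContDiffOn ℝ 1 f Ω)
    (h0 : ∀ x ∈ Ω, x ∉ K → f x = 0) (v : E) :
    IntegrableOn (fun x => fderiv ℝ f x v) Ω μ ∧ ∫ x in Ω, fderiv ℝ f x v ∂μ = 0 := by
  set G := Ω.indicator f with hG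
  have hGd : ContDiff ℝ 1 G := contDiff_indicator_of_eqOn_zero hΩ hK hKΩ hf h0
  have hG0 : ∀ x ∉ K, G x = 0 := fun x hx => by
    by_cases hxΩ : x ∈ Ω
    · rw [hG, Set.indicator_of_mem hxΩ, h0 x hxΩ hx]
    · exact Set.indicator_of_notMem hxΩ f
  have hGc : HasCompactSupport G := HasCompactSupport.intro hK hG0
  have hfG : ∀ x ∈ Ω, fderiv ℝ G x v = fderiv ℝ f x v := fun x hx => by
    rw [Filter.EventuallyEq.fderiv_eq (Filter.eventually_of_mem (hΩ.mem_nhds hx)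
      fun y hy => Set.indicator_of_mem hy f)]
  have hGout : ∀ x ∉ Ω, fderiv ℝ G x v = 0 := fun x hx => by
    have hzero : G =ᶠ[nhds x] fun _ => 0 := Filter.eventually_of_mem
      (hK.isClosed.isOpen_compl.mem_nhds fun hxK => hx (hKΩ hxK)) hG0
    rw [hzero.fderiv_eq, fderiv_fun_const, Pi.zero_apply, zero_apply]
  refine ⟨IntegrableOn.congr_fun (f := fun x => fderiv ℝ G x v) ?_ hfG hΩ.measurableSet, ?_⟩
  · exact (((hGd.continuous_fderiv (by simp)).clm_apply
      continuous_const).integrable_of_hasCompactSupport (hGc.fderiv_apply ℝ v)).integrableOn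
  · rw [← setIntegral_congr_fun hΩ.measurableSet hfG,
      setIntegral_eq_integral_of_forall_compl_eq_zero hGout,
      integral_fderiv_apply_eq_zero μ hGd hGc v]

end Divergence

lemma laplacian_eq_fderiv_fderiv {F : Type*} [NormedAddCommGroup F] [NormedSpace ℝ F] (u : ℂ → F)
    (x : ℂ) : Laplacian.laplacian u x = fderiv ℝ (fderiv ℝ u) x 1 1 +
      fderiv ℝ (fderiv ℝ u) x Complex.I Complex.I := by
  simp only [laplacian_eq_iteratedFDeriv_complexPlane, iteratedFDeriv_two_apply,
    Matrix.cons_val_zero, Matrix.cons_val_one]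

/-- A smooth nondecreasing function vanishing near `0` and approximating the identity within `2ε`.
It cuts off a potential near the boundary, where its derivatives are not controlled. -/
noncomputable def softThreshold (ε t : ℝ) : ℝ := t * Real.smoothTransition (t ^ 2 / ε ^ 2 - 1)

lemma contDiff_softThreshold (ε : ℝ) : ContDiff ℝ ∞ (softThreshold ε) := by
  have h : ContDiff ℝ ∞ Real.smoothTransition := Real.smoothTransition.contDiff
  exact contDiff_id.mul (h.comp (by fun_prop))

lemma softThreshold_eq_zero {ε t : ℝ} (hε : 0 < ε) (ht : |t| ≤ ε) : softThreshold ε t = 0 := by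
  have : t ^ 2 / ε ^ 2 - 1 ≤ 0 := by
    rw [sub_nonpos, div_le_one (by positivity)]
    exact sq_le_sq' (abs_le.1 ht).1 (abs_le.1 ht).2
  rw [softThreshold, Real.smoothTransition.zero_of_nonpos this, mul_zero]

lemma abs_softThreshold_sub_le {ε : ℝ} (hε : 0 < ε) (t : ℝ) : |softThreshold ε t - t| ≤ 2 * ε := by
  have hfactor : softThreshold ε t - t =
      t * (Real.smoothTransition (t ^ 2 / ε ^ 2 - 1) - 1) := by rw [softThreshold, mul_sub_one]
  rcases le_total (2 * ε) |t| with h | h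
  · have : 1 ≤ t ^ 2 / ε ^ 2 - 1 := by
      rw [le_sub_iff_add_le, le_div_iff₀ (by positivity), ← sq_abs t]
      nlinarith
    rw [hfactor, Real.smoothTransition.one_of_one_le this, sub_self, mul_zero, abs_zero]
    positivity
  · rw [hfactor, abs_mul]
    refine (mul_le_of_le_one_right (abs_nonneg t) (abs_le.2 ⟨?_, ?_⟩)).trans h
    · linarith [Real.smoothTransition.nonneg (t ^ 2 / ε ^ 2 - 1)]
    · linarith [Real.smoothTransition.le_one (t ^ 2 / ε ^ 2 - 1)]

lemma deriv_softThreshold_nonneg (ε t : ℝ) : 0 ≤ deriv (softThreshold ε) t := by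
  have hsmooth : ContDiff ℝ ∞ Real.smoothTransition := Real.smoothTransition.contDiff
  have hinner : HasDerivAt (fun t : ℝ => t ^ 2 / ε ^ 2 - 1) (2 * t / ε ^ 2) t := by
    simpa using ((hasDerivAt_pow 2 t).div_const (ε ^ 2)).sub_const 1
  have hcomp := ((hsmooth.differentiable (by simp)) (t ^ 2 / ε ^ 2 - 1)).hasDerivAt.comp t hinner
  have hderiv : HasDerivAt (softThreshold ε) _ t := (hasDerivAt_id t).mul hcomp
  have hstep : 0 ≤ deriv Real.smoothTransition (t ^ 2 / ε ^ 2 - 1) :=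
    Real.smoothTransition.monotone.deriv_nonneg
  calc 0 ≤ Real.smoothTransition (t ^ 2 / ε ^ 2 - 1) +
        deriv Real.smoothTransition (t ^ 2 / ε ^ 2 - 1) * (2 * t ^ 2 / ε ^ 2) :=
        add_nonneg (Real.smoothTransition.nonneg _) (mul_nonneg hstep (by positivity))
    _ = _ := by
        rw [hderiv.deriv]
        simp only [id]
        ring

variable {Ω : Set ℂ} {u ρ : ℂ → ℝ}

lemma exists_isCompact_abs_lt (hΩ : IsOpen Ω) (hb : Bornology.IsBounded Ω)
    (hc : ContinuousOn u (closure Ω)) (h0 : ∀ x ∈ frontier Ω, u x = 0) {ε : ℝ} (hε : 0 < ε) :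
    ∃ K ⊆ Ω, IsCompact K ∧ ∀ x ∈ Ω, x ∉ K → |u x| < ε := by
  refine ⟨closure Ω ∩ u ⁻¹' {t | ε ≤ |t|}, ?_, ?_, ?_⟩
  · rintro x ⟨hx, hxu⟩
    by_contra hxΩ
    rw [Set.mem_preimage, Set.mem_ofPred_eq, h0 x (hΩ.frontier_eq ▸ ⟨hx, hxΩ⟩), abs_zero] at hxu
    exact hε.not_ge hxu
  · exact hb.isCompact_closure.of_isClosed_subset (hc.preimage_isClosed_of_isClosed isClosed_closure
      (isClosed_le continuous_const continuous_abs)) Set.inter_subset_left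
  · exact fun x hx hxK => not_le.1 fun h => hxK ⟨subset_closure hx, h⟩

lemma fderiv_comp_mul_fderiv_apply {E : Type*} [NormedAddCommGroup E] [NormedSpace ℝ E]
    {φ : ℝ → ℝ} {u : E → ℝ} {x : E} (hφ : DifferentiableAt ℝ φ (u x)) (hu : ContDiffAt ℝ 2 u x)
    (v : E) : fderiv ℝ (fun x => φ (u x) * fderiv ℝ u x v) x v =
      deriv φ (u x) * fderiv ℝ u x v ^ 2 + φ (u x) * fderiv ℝ (fderiv ℝ u) x v v := by
  have hu' : HasFDerivAt u (fderiv ℝ u x) x := (hu.differentiableAt (by norm_num)).hasFDerivAt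
  have hcomp : HasFDerivAt (fun x => φ (u x)) (deriv φ (u x) • fderiv ℝ u x) x :=
    hφ.hasDerivAt.comp_hasFDerivAt x hu'
  have hu'' : HasFDerivAt (fderiv ℝ u) (fderiv ℝ (fderiv ℝ u) x) x :=
    ((hu.fderiv_right (m := 1) (by norm_num)).differentiableAt (by norm_num)).hasFDerivAt
  have happly : HasFDerivAt (fun x => fderiv ℝ u x v)
      ((ContinuousLinearMap.apply ℝ ℝ v).comp (fderiv ℝ (fderiv ℝ u) x)) x :=
    (ContinuousLinearMap.apply ℝ ℝ v).hasFDerivAt.comp x hu''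
  rw [(hcomp.fun_mul happly).fderiv]
  simp only [add_apply, smul_apply,
    ContinuousLinearMap.comp_apply, ContinuousLinearMap.apply_apply, smul_eq_mul]
  ring

/-- Green's identity turns the integral into that of `φ' (u) |∇u|²`. -/
lemma setIntegral_comp_mul_nonneg (hΩ : IsOpen Ω) {K : Set ℂ} (hK : IsCompact K) (hKΩ : K ⊆ Ω)
    {φ : ℝ → ℝ} (hφ : ContDiff ℝ 1 φ) (hφ' : ∀ t, 0 ≤ deriv φ t)
    (hφ0 : ∀ x ∈ Ω, x ∉ K → φ (u x) = 0) (hu : ContDiffOn ℝ 2 u Ω)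
    (hρ : ∀ x ∈ Ω, Laplacian.laplacian u x = -ρ x)
    (hint : IntegrableOn (fun x => φ (u x) * ρ x) Ω) : 0 ≤ ∫ x in Ω, φ (u x) * ρ x := by
  set F : ℂ → ℂ → ℝ := fun v x => φ (u x) * fderiv ℝ u x v
  have hu' : ContDiffOn ℝ 1 (fderiv ℝ u) Ω := hu.fderiv_of_isOpen hΩ (by norm_num)
  have hF : ∀ v, ContDiffOn ℝ 1 (F v) Ω := fun v =>
    (hφ.comp_contDiffOn (hu.of_le (by norm_num))).mul (hu'.clm_apply contDiffOn_const)
  have hflux := fun v => integrableOn_and_setIntegral_fderiv_apply_eq_zero volume hΩ hK hKΩ (hF v)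
    (fun x hx hxK => mul_eq_zero_of_left (hφ0 x hx hxK) _) v
  calc 0 ≤ ∫ x in Ω, deriv φ (u x) * (fderiv ℝ u x 1 ^ 2 + fderiv ℝ u x Complex.I ^ 2) :=
        integral_nonneg fun x => mul_nonneg (hφ' _) (by positivity)
    _ = ∫ x in Ω, (φ (u x) * ρ x + fderiv ℝ (F 1) x 1 + fderiv ℝ (F Complex.I) x Complex.I) := by
        refine setIntegral_congr_fun hΩ.measurableSet fun x hx => ?_
        have hderiv := fun v => fderiv_comp_mul_fderiv_apply
          (hφ.differentiable (by norm_num) (u x)) (hu.contDiffAt (hΩ.mem_nhds hx)) v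
        have hlaplace := hρ x hx
        rw [laplacian_eq_fderiv_fderiv] at hlaplace
        simp only [F, hderiv]
        linear_combination (-φ (u x)) * hlaplace
    _ = ∫ x in Ω, φ (u x) * ρ x := by
        have hint1 : IntegrableOn (fun x => φ (u x) * ρ x + fderiv ℝ (F 1) x 1) Ω :=
          hint.add (hflux 1).1
        rw [integral_add hint1 (hflux Complex.I).1, integral_add hint (hflux 1).1,
          (hflux 1).2, (hflux Complex.I).2, add_zero, add_zero]

lemma setIntegral_mul_nonneg_of_laplacian (hΩ : IsOpen Ω) (hb : Bornology.IsBounded Ω)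
    (hc : ContinuousOn u (closure Ω)) (h0 : ∀ x ∈ frontier Ω, u x = 0)
    (hu : ContDiffOn ℝ 2 u Ω) (hρ : ∀ x ∈ Ω, Laplacian.laplacian u x = -ρ x)
    (hρc : ContinuousOn ρ (closure Ω)) : 0 ≤ ∫ x in Ω, u x * ρ x := by
  have hint : ∀ w : ℂ → ℝ, ContinuousOn w (closure Ω) → IntegrableOn w Ω := fun w hw =>
    (hw.integrableOn_compact hb.isCompact_closure).mono_set subset_closure
  have huρ : IntegrableOn (fun x => u x * ρ x) Ω := hint _ (hc.mul hρc)
  have habs := hint _ hρc.abs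
  set M := ∫ x in Ω, |ρ x|
  have hM : 0 ≤ M := integral_nonneg fun x => abs_nonneg _
  have approx : ∀ ε > 0, 0 ≤ (∫ x in Ω, u x * ρ x) + 2 * ε * M := by
    intro ε hε
    obtain ⟨K, hKΩ, hK, hKu⟩ := exists_isCompact_abs_lt hΩ hb hc h0 hε
    have htrunc : IntegrableOn (fun x => softThreshold ε (u x) * ρ x) Ω := hint _
      (((contDiff_softThreshold ε).continuous.comp_continuousOn hc).mul hρc)
    calc 0 ≤ ∫ x in Ω, softThreshold ε (u x) * ρ x :=
          setIntegral_comp_mul_nonneg hΩ hK hKΩ ((contDiff_softThreshold ε).of_le (by simp))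
            (deriv_softThreshold_nonneg ε)
            (fun x hx hxK => softThreshold_eq_zero hε (hKu x hx hxK).le) hu hρ htrunc
      _ ≤ ∫ x in Ω, (u x * ρ x + 2 * ε * |ρ x|) := by
          refine integral_mono htrunc (huρ.add (habs.const_mul _)) fun x => ?_
          have hdiff : (softThreshold ε (u x) - u x) * ρ x ≤ 2 * ε * |ρ x| :=
            (le_abs_self _).trans (by
              rw [abs_mul]
              gcongr
              exact abs_softThreshold_sub_le hε _)
          simp only
          linarith
      _ = _ := by rw [integral_add huρ (habs.const_mul _), integral_const_mul]
  refine le_of_forall_pos_le_add fun δ hδ => (approx (δ / (2 * (M + 1))) (by positivity)).trans ?_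
  gcongr
  rw [mul_assoc, mul_comm (δ / _), ← mul_assoc, mul_div_assoc', div_le_iff₀ (by positivity)]
  nlinarith

end Energy

section RadialFunctions

variable {E : Type*} [NormedAddCommGroup E] [InnerProductSpace ℝ E] (c : E) (k : ℝ)

lemma hasFDerivAt_norm_sub_sq_div (x : E) :
    HasFDerivAt (fun x => ‖x - c‖ ^ 2 / k) ((2 / k) • innerSL ℝ (x - c)) x := by
  have h : HasFDerivAt (fun x => ‖x - c‖ ^ 2) (2 • innerSL ℝ (x - c)) x := by
    simpa only [id_eq, ContinuousLinearMap.comp_id] using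
      ((hasFDerivAt_id x).sub_const c).norm_sq
  refine (h.mul_const k⁻¹).congr_fderiv ?_
  rw [← Nat.cast_smul_eq_nsmul ℝ, smul_smul, mul_comm, div_eq_mul_inv, Nat.cast_ofNat]

variable {f : ℝ → ℝ}

lemma fderiv_comp_norm_sub_sq_div (hf : Differentiable ℝ f) (x : E) :
    fderiv ℝ (fun x => f (‖x - c‖ ^ 2 / k)) x =
      (deriv f (‖x - c‖ ^ 2 / k) * (2 / k)) • innerSL ℝ (x - c) := by
  rw [mul_smul]
  exact ((hf _).hasDerivAt.comp_hasFDerivAt x (hasFDerivAt_norm_sub_sq_div c k x)).fderiv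

lemma fderiv_fderiv_comp_norm_sub_sq_div_apply (hf : ContDiff ℝ 2 f) (x v : E) :
    fderiv ℝ (fderiv ℝ fun x => f (‖x - c‖ ^ 2 / k)) x v v =
      (2 / k) ^ 2 * deriv (deriv f) (‖x - c‖ ^ 2 / k) * inner ℝ (x - c) v ^ 2 +
        2 / k * deriv f (‖x - c‖ ^ 2 / k) * ‖v‖ ^ 2 := by
  have hf1 : Differentiable ℝ f := hf.differentiable (by norm_num)
  have hf2 : Differentiable ℝ (deriv f) := hf.differentiable_deriv_two
  have h_inner : HasFDerivAt (fun y : E => inner ℝ (y - c) v) (innerSL ℝ v) x :=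
    ((innerSL ℝ v).hasFDerivAt.comp x ((hasFDerivAt_id x).sub_const c)).congr_of_eventuallyEq
      (.of_forall fun y => real_inner_comm _ _)
  have h_coeff : HasFDerivAt (fun y => deriv f (‖y - c‖ ^ 2 / k)) _ x :=
    (hf2 _).hasDerivAt.comp_hasFDerivAt x (hasFDerivAt_norm_sub_sq_div c k x)
  have h_diff : DifferentiableAt ℝ (fderiv ℝ fun x => f (‖x - c‖ ^ 2 / k)) x := by
    rw [funext (fderiv_comp_norm_sub_sq_div c k hf1)]
    exact (h_coeff.differentiableAt.mul_const _).smul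
      ((innerSL ℝ (E := E)).differentiable.comp (differentiable_id.sub_const c) x)
  have h_apply : (fun y => fderiv ℝ (fun x => f (‖x - c‖ ^ 2 / k)) y v) =
      fun y => deriv f (‖y - c‖ ^ 2 / k) * (2 / k * inner ℝ (y - c) v) := by
    funext y
    rw [fderiv_comp_norm_sub_sq_div c k hf1, smul_apply, innerSL_apply_apply, smul_eq_mul,
      mul_assoc]
  calc fderiv ℝ (fderiv ℝ fun x => f (‖x - c‖ ^ 2 / k)) x v v
      = fderiv ℝ (fun y => fderiv ℝ (fun x => f (‖x - c‖ ^ 2 / k)) y v) x v := by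
        rw [fderiv_clm_apply h_diff (differentiableAt_const v)]
        simp
    _ = _ := by
        rw [h_apply, (h_coeff.fun_mul (h_inner.const_mul (2 / k))).fderiv]
        simp only [add_apply, smul_apply, innerSL_apply_apply, smul_eq_mul,
          real_inner_self_eq_norm_sq]
        ring

lemma laplacian_comp_norm_sub_sq_div (c : ℂ) (k : ℝ) (hf : ContDiff ℝ 2 f) (x : ℂ) :
    Laplacian.laplacian (fun x => f (‖x - c‖ ^ 2 / k)) x =
      4 / k * (deriv f (‖x - c‖ ^ 2 / k) +
        ‖x - c‖ ^ 2 / k * deriv (deriv f) (‖x - c‖ ^ 2 / k)) := by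
  have h_norm : ‖x - c‖ ^ 2 = inner ℝ (x - c) 1 ^ 2 + inner ℝ (x - c) Complex.I ^ 2 := by
    rw [← Complex.normSq_eq_norm_sq, Complex.normSq_apply]
    simp only [Complex.inner, map_sub, Complex.mul_re, Complex.sub_re, Complex.sub_im,
      Complex.conj_re, Complex.conj_im, Complex.one_re, Complex.one_im, Complex.I_re, Complex.I_im]
    ring
  rw [laplacian_eq_fderiv_fderiv, fderiv_fderiv_comp_norm_sub_sq_div_apply c k hf,
    fderiv_fderiv_comp_norm_sub_sq_div_apply c k hf, norm_one, Complex.norm_I]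
  generalize deriv f (‖x - c‖ ^ 2 / k) = a
  generalize deriv (deriv f) (‖x - c‖ ^ 2 / k) = b
  rw [h_norm]
  ring

variable {v : ℂ → ℝ} {c : ℂ} {r : ℝ}

lemma setIntegral_comp_circleMap_of_harmonicOnNhd (hv : HarmonicOnNhd v (Metric.closedBall c r))
    (hr : 0 < r) :
    ∫ θ in Set.Ioo (-Real.pi) Real.pi, v (circleMap c r θ) = 2 * Real.pi * v c := by
  have h_mean := InnerProductSpace.HarmonicOnNhd.circleAverage_eq (R := r) (by rwa [abs_of_pos hr])
  have h_periodic : Function.Periodic (fun θ => v (circleMap c r θ)) (2 * Real.pi) := fun θ => by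
    simp only [periodic_circleMap c r θ]
  have h_shift := h_periodic.intervalIntegral_add_eq (-Real.pi) 0
  rw [show -Real.pi + 2 * Real.pi = Real.pi by ring, zero_add] at h_shift
  rw [← h_mean, Real.circleAverage_def, smul_eq_mul, mul_inv_cancel_left₀ (by positivity),
    ← integral_Ioc_eq_integral_Ioo,
    ← intervalIntegral.integral_of_le (by linarith [Real.pi_pos]), h_shift]

variable {ψ : ℝ → ℝ}

lemma integrableOn_polar_mul_radial (hv : ContinuousOn v (Metric.closedBall c r))
    (hψ : Continuous ψ) (hψ0 : ∀ τ, r ≤ τ → ψ τ = 0) :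
    IntegrableOn (fun p : ℝ × ℝ => p.1 * (v (circleMap c p.1 p.2) * ψ p.1))
      (Set.Ioi 0 ×ˢ Set.Ioo (-Real.pi) Real.pi) := by
  have h_maps : Set.MapsTo (fun p : ℝ × ℝ => circleMap c p.1 p.2)
      (Set.Icc 0 r ×ˢ Set.Icc (-Real.pi) Real.pi) (Metric.closedBall c r) := fun p hp => by
    rw [Metric.mem_closedBall, dist_eq_norm, circleMap_sub_center, norm_circleMap_zero,
      abs_of_nonneg hp.1.1]
    exact hp.1.2
  have h_cont : ContinuousOn (fun p : ℝ × ℝ => p.1 * (v (circleMap c p.1 p.2) * ψ p.1))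
      (Set.Icc 0 r ×ˢ Set.Icc (-Real.pi) Real.pi) := by
    refine continuous_fst.continuousOn.mul
      ((hv.comp (Continuous.continuousOn ?_) h_maps).mul (hψ.comp continuous_fst).continuousOn)
    unfold circleMap
    fun_prop
  refine ((h_cont.integrableOn_compact (isCompact_Icc.prod isCompact_Icc)).mono_set
    (Set.prod_mono Set.Ioc_subset_Icc_self Set.Ioo_subset_Icc_self :
      Set.Ioc 0 r ×ˢ Set.Ioo (-Real.pi) Real.pi ⊆ _)).of_forall_sdiff_eq_zero
    (measurableSet_Ioi.prod measurableSet_Ioo) ?_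
  rintro p ⟨hp, hp'⟩
  have hrp : r ≤ p.1 := by
    by_contra! hlt
    exact hp' ⟨⟨hp.1, hlt.le⟩, hp.2⟩
  simp only [hψ0 _ hrp, mul_zero]

lemma integral_harmonic_mul_radial (hv : HarmonicOnNhd v (Metric.closedBall c r))
    (hψ : Continuous ψ) (hψ0 : ∀ τ, r ≤ τ → ψ τ = 0) :
    ∫ x, v x * ψ ‖x - c‖ = v c * (2 * Real.pi * ∫ τ in Set.Ioi (0 : ℝ), τ * ψ τ) := by
  have h_angular : ∀ τ ∈ Set.Ioi (0 : ℝ),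
      ∫ θ in Set.Ioo (-Real.pi) Real.pi, τ * (v (circleMap c τ θ) * ψ τ) =
        v c * (2 * Real.pi) * (τ * ψ τ) := by
    intro τ hτ
    rcases le_or_gt r τ with h | h
    · simp only [hψ0 _ h, mul_zero, integral_zero]
    rw [integral_const_mul, integral_mul_const, setIntegral_comp_circleMap_of_harmonicOnNhd
      (hv.mono (Metric.closedBall_subset_closedBall h.le)) hτ]
    ring
  calc ∫ x, v x * ψ ‖x - c‖ = ∫ z, v (c + z) * ψ ‖z‖ := by
        rw [← integral_add_left_eq_self _ c]
        simp only [add_sub_cancel_left]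
    _ = ∫ p in Set.Ioi (0 : ℝ) ×ˢ Set.Ioo (-Real.pi) Real.pi,
          p.1 * (v (circleMap c p.1 p.2) * ψ p.1) := by
        rw [← Complex.integral_comp_polarCoord_symm, polarCoord_target]
        refine setIntegral_congr_fun (measurableSet_Ioi.prod measurableSet_Ioo) fun p hp => ?_
        have hp1 : 0 < p.1 := hp.1
        simp only [Complex.norm_polarCoord_symm, abs_of_pos hp1, smul_eq_mul]
        simp only [Complex.polarCoord_symm_apply, circleMap, Complex.exp_mul_I,
          Complex.ofReal_cos, Complex.ofReal_sin]
    _ = ∫ τ in Set.Ioi (0 : ℝ), ∫ θ in Set.Ioo (-Real.pi) Real.pi,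
          τ * (v (circleMap c τ θ) * ψ τ) := by
        rw [Measure.volume_eq_prod,
          setIntegral_prod _ (integrableOn_polar_mul_radial hv.continuousOn hψ hψ0)]
    _ = v c * (2 * Real.pi * ∫ τ in Set.Ioi (0 : ℝ), τ * ψ τ) := by
        rw [setIntegral_congr_fun measurableSet_Ioi h_angular, integral_const_mul, mul_assoc]

end RadialFunctions

section Smearing

/-- A smooth function of `q = |z|²` which equals `-log |z|` for `|z| ≥ 1`: the logarithmic potential
of a unit charge smeared out radially over the unit disc. -/
noncomputable def smearProfile (q : ℝ) : ℝ :=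
  -(1 / 2) * (Real.smoothTransition (2 * q - 1) * Real.log q)

lemma smearProfile_of_one_le {q : ℝ} (hq : 1 ≤ q) : smearProfile q = -(1 / 2) * Real.log q := by
  rw [smearProfile, Real.smoothTransition.one_of_one_le (by linarith), one_mul]

lemma contDiff_smearProfile : ContDiff ℝ ∞ smearProfile := by
  rw [contDiff_iff_contDiffAt]
  intro q
  rcases lt_or_ge q (1 / 2) with hq | hq
  · have h_zero : smearProfile =ᶠ[nhds q] fun _ => 0 := by
      filter_upwards [Iio_mem_nhds hq] with y hy
      rw [smearProfile, Real.smoothTransition.zero_of_nonpos (by linarith [Set.mem_Iio.1 hy]),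
        zero_mul, mul_zero]
    exact contDiffAt_const.congr_of_eventuallyEq h_zero
  · have h_cutoff : ContDiff ℝ ∞ fun q : ℝ => Real.smoothTransition (2 * q - 1) :=
      Real.smoothTransition.contDiff.comp (by fun_prop)
    exact contDiffAt_const.mul
      (h_cutoff.contDiffAt.mul (Real.contDiffAt_log.2 (by linarith)))

lemma contDiff_deriv_smearProfile : ContDiff ℝ ∞ (deriv smearProfile) :=
  (contDiff_infty_iff_deriv.1 contDiff_smearProfile).2

lemma deriv_smearProfile {q : ℝ} (hq : 1 < q) : deriv smearProfile q = -(1 / 2) * q⁻¹ := by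
  have h_eq : smearProfile =ᶠ[nhds q] fun q => -(1 / 2) * Real.log q := by
    filter_upwards [Ioi_mem_nhds hq] with y hy
    exact smearProfile_of_one_le (Set.mem_Ioi.1 hy).le
  rw [h_eq.deriv_eq]
  exact ((Real.hasDerivAt_log (by linarith)).const_mul _).deriv

/-- The charge density, as a function of `q = |z|²`, whose logarithmic potential is
`z ↦ smearProfile (|z|²)`; that is, minus the Laplacian of that function. -/
noncomputable def smearCharge (q : ℝ) : ℝ :=
  -(4 * (deriv smearProfile q + q * deriv (deriv smearProfile) q))

@[fun_prop]
lemma continuous_smearCharge : Continuous smearCharge := by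
  have h₁ := contDiff_deriv_smearProfile.continuous
  have h₂ := (contDiff_infty_iff_deriv.1 contDiff_deriv_smearProfile).2.continuous
  unfold smearCharge
  fun_prop

lemma smearCharge_eq_zero {q : ℝ} (hq : 1 ≤ q) : smearCharge q = 0 := by
  have h_Ioi : Set.Ioi (1 : ℝ) ⊆ {q | smearCharge q = 0} := by
    intro q (hq : 1 < q)
    have h_eq : deriv smearProfile =ᶠ[nhds q] fun q => -(1 / 2) * q⁻¹ := by
      filter_upwards [Ioi_mem_nhds hq] with y hy using deriv_smearProfile hy
    rw [Set.mem_ofPred_eq, smearCharge, deriv_smearProfile hq, h_eq.deriv_eq,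
      ((hasDerivAt_inv (by linarith : q ≠ 0)).const_mul _).deriv]
    field_simp
    ring
  have h_closed := isClosed_eq continuous_smearCharge (continuous_const (y := (0 : ℝ)))
  exact h_closed.closure_subset_iff.2 h_Ioi (closure_Ioi (1 : ℝ) ▸ hq)

/-- The potential of a unit charge at `c` smeared out over the disc of radius `r`, normalised to be
`-log |x - c|` outside that disc. -/
noncomputable def smearPotential (c : ℂ) (r : ℝ) (x : ℂ) : ℝ :=
  smearProfile (‖x - c‖ ^ 2 / r ^ 2) - Real.log r

/-- The density of a charge `2π` at `c` smeared out over the disc of radius `r`, the source of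
`smearPotential c r`. -/
noncomputable def smearDensity (c : ℂ) (r : ℝ) (x : ℂ) : ℝ :=
  (r ^ 2)⁻¹ * smearCharge (‖x - c‖ ^ 2 / r ^ 2)

lemma contDiff_smearPotential (c : ℂ) (r : ℝ) : ContDiff ℝ ∞ (smearPotential c r) :=
  (contDiff_smearProfile.comp
    (((contDiff_id.sub contDiff_const).norm_sq ℝ).div_const _)).sub contDiff_const

lemma continuous_smearDensity (c : ℂ) (r : ℝ) : Continuous (smearDensity c r) := by
  unfold smearDensity
  fun_prop

variable {c x : ℂ} {r : ℝ}

lemma smearPotential_eq_log (hr : 0 < r) (hx : r ≤ ‖x - c‖) :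
    smearPotential c r x = Real.log ‖x - c‖⁻¹ := by
  have hx0 : 0 < ‖x - c‖ := hr.trans_le hx
  have hq : 1 ≤ ‖x - c‖ ^ 2 / r ^ 2 := (one_le_div (by positivity)).2 (by gcongr)
  rw [smearPotential, smearProfile_of_one_le hq, Real.log_div (by positivity) (by positivity),
    Real.log_pow, Real.log_pow, Real.log_inv]
  push_cast
  ring

lemma smearCharge_sq_div_eq_zero {τ : ℝ} (hr : 0 < r) (hτ : r ≤ τ) :
    smearCharge (τ ^ 2 / r ^ 2) = 0 :=
  smearCharge_eq_zero ((one_le_div (by positivity)).2 (by gcongr))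

lemma smearDensity_eq_zero (hr : 0 < r) (hx : r ≤ ‖x - c‖) : smearDensity c r x = 0 := by
  rw [smearDensity, smearCharge_sq_div_eq_zero hr hx, mul_zero]

lemma smearDensity_eq_zero_of_notMem (hr : 0 < r) (hx : x ∉ Metric.closedBall c r) :
    smearDensity c r x = 0 :=
  smearDensity_eq_zero hr (by rw [← dist_eq_norm]; exact (not_le.1 hx).le)

lemma laplacian_smearPotential (c : ℂ) (r : ℝ) (x : ℂ) :
    Laplacian.laplacian (smearPotential c r) x = -smearDensity c r x := by
  have h := laplacian_comp_norm_sub_sq_div (f := fun q => smearProfile q - Real.log r) c (r ^ 2)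
    ((contDiff_infty.1 contDiff_smearProfile 2).sub contDiff_const) x
  simp only [deriv_sub_const_fun] at h
  rw [smearDensity, smearCharge]
  exact h.trans (by ring)

lemma harmonicAt_smearPotential (hr : 0 < r) (hx : r < ‖x - c‖) :
    HarmonicAt (smearPotential c r) x := by
  refine ⟨(contDiff_infty.1 (contDiff_smearPotential c r) 2).contDiffAt, ?_⟩
  have h_open : IsOpen {x : ℂ | r < ‖x - c‖} := isOpen_lt continuous_const (by fun_prop)
  filter_upwards [h_open.mem_nhds hx] with y (hy : r < ‖y - c‖)
  rw [laplacian_smearPotential, smearDensity_eq_zero hr hy.le, neg_zero, Pi.zero_apply]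

/-- Gauss' law for the smeared charge: the primitive `τ ↦ -2 q ψ'(q)` with `q = τ² / r²`, where `ψ`
is `smearProfile`, is constant equal to `1` beyond `r`. -/
lemma integral_mul_smearCharge (hr : 0 < r) :
    ∫ τ in Set.Ioi (0 : ℝ), τ * ((r ^ 2)⁻¹ * smearCharge (τ ^ 2 / r ^ 2)) = 1 := by
  have h_sq (τ : ℝ) : HasDerivAt (fun τ : ℝ => τ ^ 2 / r ^ 2) (2 * τ / r ^ 2) τ := by
    simpa using (hasDerivAt_pow 2 τ).div_const (r ^ 2)
  have h_primitive (τ : ℝ) :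
      HasDerivAt (fun τ => -2 * (τ ^ 2 / r ^ 2 * deriv smearProfile (τ ^ 2 / r ^ 2)))
        (τ * ((r ^ 2)⁻¹ * smearCharge (τ ^ 2 / r ^ 2))) τ := by
    have h_deriv := (contDiff_deriv_smearProfile.differentiable (by norm_num)
      (τ ^ 2 / r ^ 2)).hasDerivAt.comp τ (h_sq τ)
    refine (((h_sq τ).mul h_deriv).const_mul (-2)).congr_deriv ?_
    simp only [smearCharge, Function.comp]
    field_simp
    ring
  have h_cont : Continuous fun τ => τ * ((r ^ 2)⁻¹ * smearCharge (τ ^ 2 / r ^ 2)) := by fun_prop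
  rw [setIntegral_eq_of_subset_of_forall_sdiff_eq_zero (s := Set.Ioc 0 (2 * r)) measurableSet_Ioi
      Set.Ioc_subset_Ioi_self, ← intervalIntegral.integral_of_le (by positivity),
    intervalIntegral.integral_eq_sub_of_hasDerivAt (fun τ _ => h_primitive τ)
      (h_cont.intervalIntegrable _ _)]
  · have h_four : (2 * r) ^ 2 / r ^ 2 = 4 := by
      field_simp
      norm_num
    rw [h_four, deriv_smearProfile (by norm_num)]
    norm_num
  · rintro τ ⟨hτ0, hτ⟩
    have h : 2 * r < τ := by
      by_contra! hle
      exact hτ ⟨hτ0, hle⟩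
    rw [smearCharge_sq_div_eq_zero hr (by linarith), mul_zero, mul_zero]

lemma integral_harmonic_mul_smearDensity {v : ℂ → ℝ} (hr : 0 < r)
    (hv : HarmonicOnNhd v (Metric.closedBall c r)) :
    ∫ x, v x * smearDensity c r x = 2 * Real.pi * v c := by
  have h := integral_harmonic_mul_radial hv
    (by fun_prop : Continuous fun τ : ℝ => (r ^ 2)⁻¹ * smearCharge (τ ^ 2 / r ^ 2))
    fun τ hτ => by rw [smearCharge_sq_div_eq_zero hr hτ, mul_zero]
  rw [integral_mul_smearCharge hr] at h
  exact h.trans (by ring)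

/-- The electrostatic self-energy of the charge smeared out over the unit disc. -/
noncomputable def selfEnergy : ℝ := ∫ x : ℂ, smearProfile (‖x‖ ^ 2) * smearCharge (‖x‖ ^ 2)

lemma integral_comp_norm_sub_sq_div (g : ℝ → ℝ) (c : ℂ) (hr : 0 < r) :
    ∫ x : ℂ, g (‖x - c‖ ^ 2 / r ^ 2) = r ^ 2 * ∫ x : ℂ, g (‖x‖ ^ 2) := by
  have h_scale (x : ℂ) : ‖r⁻¹ • x‖ ^ 2 = ‖x‖ ^ 2 / r ^ 2 := by
    rw [norm_smul, Real.norm_eq_abs, abs_of_pos (inv_pos.2 hr)]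
    field_simp
  have h := Measure.integral_comp_inv_smul (volume : Measure ℂ) (fun x => g (‖x‖ ^ 2)) r
  simp only [h_scale, Complex.finrank_real_complex, abs_of_pos (pow_pos hr 2), smul_eq_mul] at h
  rw [← h, integral_sub_right_eq_self (fun x : ℂ => g (‖x‖ ^ 2 / r ^ 2)) c]

lemma hasCompactSupport_smearDensity (c : ℂ) (hr : 0 < r) :
    HasCompactSupport (smearDensity c r) :=
  HasCompactSupport.intro (isCompact_closedBall c r) fun _ => smearDensity_eq_zero_of_notMem hr

lemma integral_smearPotential_mul_smearDensity (c : ℂ) (hr : 0 < r) :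
    ∫ x, smearPotential c r x * smearDensity c r x = selfEnergy - 2 * Real.pi * Real.log r := by
  have h_density := continuous_smearDensity c r
  have h_support := hasCompactSupport_smearDensity c hr
  have h_profile : Continuous fun x : ℂ => smearProfile (‖x - c‖ ^ 2 / r ^ 2) :=
    contDiff_smearProfile.continuous.comp (by fun_prop)
  have h_unit : ∫ x, smearProfile (‖x - c‖ ^ 2 / r ^ 2) * smearDensity c r x = selfEnergy := by
    simp only [smearDensity, mul_left_comm _ (r ^ 2)⁻¹]
    rw [integral_const_mul,
      integral_comp_norm_sub_sq_div (fun q => smearProfile q * smearCharge q) c hr,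
      inv_mul_cancel_left₀ (by positivity), selfEnergy]
  have h_log : ∫ x, Real.log r * smearDensity c r x = 2 * Real.pi * Real.log r :=
    integral_harmonic_mul_smearDensity hr (harmonicOnNhd_const _)
  have h_int {w : ℂ → ℝ} (hw : Continuous w) : Integrable fun x => w x * smearDensity c r x :=
    (hw.mul h_density).integrable_of_hasCompactSupport h_support.mul_left
  simp only [smearPotential, sub_mul]
  rw [integral_sub (h_int h_profile) (h_int continuous_const), h_unit, h_log]

end Smearing

section HarmonicFunctions

lemma eventually_eq_of_harmonicAt_of_isLocalMax {h : ℂ → ℝ} {a : ℂ} (hh : HarmonicAt h a)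
    (hmax : IsLocalMax h a) : ∀ᶠ z in nhds a, h z = h a := by
  obtain ⟨r, hr, hball⟩ := Metric.eventually_nhds_iff_ball.1 hh.eventually
  obtain ⟨F, hF, hFh⟩ := HarmonicOnNhd.exists_analyticOnNhd_ball_re_eq hball
  have h_re : ∀ᶠ z in nhds a, ‖Complex.exp (F z)‖ = Real.exp (h z) := by
    filter_upwards [Metric.ball_mem_nhds a hr] with z hz
    rw [Complex.norm_exp, ← hFh hz]
  have h_diff : ∀ᶠ z in nhds a, DifferentiableAt ℂ (fun z => Complex.exp (F z)) z := by
    filter_upwards [Metric.ball_mem_nhds a hr] with z hz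
    exact (hF z hz).differentiableAt.cexp
  have h_localMax : IsLocalMax (norm ∘ fun z => Complex.exp (F z)) a := by
    filter_upwards [hmax, h_re] with z hz hz'
    simpa only [Function.comp_apply, hz', h_re.self_of_nhds, Real.exp_le_exp] using hz
  filter_upwards [Complex.norm_eventually_eq_of_isLocalMax h_diff h_localMax, h_re] with z hz hz'
  rwa [hz', h_re.self_of_nhds, Real.exp_eq_exp] at hz

lemma harmonicContOnCl_le_of_frontier_le {Ω : Set ℂ} (hΩ : IsOpen Ω)
    (hb : Bornology.IsBounded Ω) {h : ℂ → ℝ} (hh : HarmonicContOnCl h Ω) {B : ℝ}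
    (hB : ∀ z ∈ frontier Ω, h z ≤ B) {z : ℂ} (hz : z ∈ closure Ω) : h z ≤ B := by
  by_contra! hlt
  have h_compact : IsCompact (closure Ω) := hb.isCompact_closure
  obtain ⟨m, hm, hmax⟩ := h_compact.exists_isMaxOn ⟨z, hz⟩ hh.continuousOn
  -- Among the maximum points, one with the largest real part cannot be interior.
  obtain ⟨a, ⟨ha, ham : h a = h m⟩, ha_re⟩ := (h_compact.of_isClosed_subset
    (hh.continuousOn.preimage_isClosed_of_isClosed isClosed_closure isClosed_singleton)
    Set.inter_subset_left).exists_isMaxOn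
      (⟨m, hm, rfl⟩ : (closure Ω ∩ h ⁻¹' {h m}).Nonempty) Complex.continuous_re.continuousOn
  have haΩ : a ∈ Ω := by
    by_contra hna
    exact ((hlt.trans_le (hmax hz)).trans_eq ham.symm).not_ge
      (hB a (hΩ.frontier_eq ▸ ⟨ha, hna⟩))
  have h_localMax : IsLocalMax h a := by
    filter_upwards [hΩ.mem_nhds haΩ] with w hw using (hmax (subset_closure hw)).trans_eq ham.symm
  obtain ⟨r, hr, hr_max⟩ := Metric.eventually_nhds_iff_ball.1
    ((hΩ.eventually_mem haΩ).and
      (eventually_eq_of_harmonicAt_of_isLocalMax (hh.harmonicOnNhd a haΩ) h_localMax))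
  have h_shift : a + (r / 2 : ℝ) ∈ Metric.ball a r := by
    rw [Metric.mem_ball, dist_self_add_left, Complex.norm_real, Real.norm_eq_abs,
      abs_of_pos (by positivity)]
    linarith
  have h_re := ha_re (a := a + (r / 2 : ℝ))
    ⟨subset_closure (hr_max _ h_shift).1, (hr_max _ h_shift).2.trans ham⟩
  simp only [Set.mem_ofPred_eq, Complex.add_re, Complex.ofReal_re] at h_re
  linarith

lemma laplacian_sum_mul {E ι : Type*} [NormedAddCommGroup E] [InnerProductSpace ℝ E]
    [FiniteDimensional ℝ E] (s : Finset ι) (α : ι → ℝ) {V : ι → E → ℝ} {x : E}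
    (hV : ∀ k ∈ s, ContDiffAt ℝ 2 (V k) x) :
    Laplacian.laplacian (fun y => ∑ k ∈ s, α k * V k y) x =
      ∑ k ∈ s, α k * Laplacian.laplacian (V k) x := by
  classical
  induction s using Finset.induction_on with
  | empty => simp only [Finset.sum_empty, laplacian_const, Pi.zero_apply]
  | insert i s hi ih =>
    have h_insert : (fun y => ∑ k ∈ insert i s, α k * V k y) =
        α i • V i + fun y => ∑ k ∈ s, α k * V k y := by
      funext y
      simp only [Finset.sum_insert hi, Pi.add_apply, Pi.smul_apply, smul_eq_mul]
    have hs : ContDiffAt ℝ 2 (fun y => ∑ k ∈ s, α k * V k y) x :=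
      ContDiffAt.sum fun k hk => contDiffAt_const.mul (hV k (Finset.mem_insert_of_mem hk))
    have hVi := hV i (Finset.mem_insert_self i s)
    have hαVi : ContDiffAt ℝ 2 (α i • V i) x := contDiffAt_const.smul hVi
    rw [h_insert, hαVi.laplacian_add hs,
      laplacian_smul _ hVi, ih fun k hk => hV k (Finset.mem_insert_of_mem hk),
      Finset.sum_insert hi, smul_eq_mul]

end HarmonicFunctions

section Onsager

variable {Ω : Set ℂ} {g : ℂ → ℂ → ℝ}

lemma IsGreenRegularPart.le_log (hΩ : IsOpen Ω) (hb : Bornology.IsBounded Ω)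
    (hg : IsGreenRegularPart Ω g) {R : ℝ} (hR : ∀ x ∈ closure Ω, ∀ y ∈ closure Ω, ‖x - y‖ ≤ R)
    {x y : ℂ} (hx : x ∈ Ω) (hy : y ∈ Ω) : g x y ≤ (2 * Real.pi)⁻¹ * Real.log R := by
  refine harmonicContOnCl_le_of_frontier_le hΩ hb (hg.harmonic y hy) (fun z hz => ?_)
    (subset_closure hx)
  have hzy : 0 < ‖z - y‖ := by
    rw [norm_pos_iff, sub_ne_zero]
    rintro rfl
    exact (hΩ.frontier_eq ▸ hz).2 hy
  rw [hg.boundary y hy z hz, Real.log_inv, mul_neg, neg_neg]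
  gcongr
  exact hR z (frontier_subset_closure hz) y (subset_closure hy)

lemma sum_sum_eq_sum_diag_add_two_mul_sum_Ioi {ι R : Type*} [Fintype ι] [LinearOrder ι]
    [LocallyFiniteOrderTop ι] [LocallyFiniteOrderBot ι] [CommSemiring R] {f : ι → ι → R}
    (hf : ∀ k l, f k l = f l k) :
    ∑ k, ∑ l, f k l = ∑ k, f k k + 2 * ∑ k, ∑ l ∈ Finset.Ioi k, f k l := by
  have h_split (k : ι) :
      ∑ l, f k l = f k k + (∑ l ∈ Finset.Ioi k, f k l + ∑ l ∈ Finset.Iio k, f k l) := by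
    have h_univ : (Finset.univ : Finset ι) = insert k (Finset.Ioi k ∪ Finset.Iio k) := by
      ext l
      rcases lt_trichotomy l k with h | h | h <;> simp [h]
    rw [h_univ, Finset.sum_insert (by simp), Finset.sum_union]
    exact Finset.disjoint_left.2 fun l hl hl' =>
      (Finset.mem_Ioi.1 hl).not_gt (Finset.mem_Iio.1 hl')
  have h_swap : ∑ k, ∑ l ∈ Finset.Iio k, f k l = ∑ k, ∑ l ∈ Finset.Ioi k, f k l := by
    rw [Finset.sum_comm' (t' := Finset.univ) (s' := fun l => Finset.Ioi l) (by simp)]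
    exact Finset.sum_congr rfl fun k _ => Finset.sum_congr rfl fun l _ => hf _ _
  simp only [h_split, Finset.sum_add_distrib, h_swap, two_mul]

lemma setIntegral_mul_smearDensity {c : ℂ} {r : ℝ} (hr : 0 < r)
    (hball : Metric.closedBall c r ⊆ Ω) (w : ℂ → ℝ) :
    ∫ x in Ω, w x * smearDensity c r x = ∫ x, w x * smearDensity c r x :=
  setIntegral_eq_integral_of_forall_compl_eq_zero fun x hx => by
    rw [smearDensity_eq_zero_of_notMem hr fun hx' => hx (hball hx'), mul_zero]

lemma integrableOn_mul_smearDensity (hb : Bornology.IsBounded Ω) (c : ℂ) (r : ℝ) {w : ℂ → ℝ}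
    (hw : ContinuousOn w (closure Ω)) : IntegrableOn (fun x => w x * smearDensity c r x) Ω :=
  ((hw.mul (continuous_smearDensity c r).continuousOn).integrableOn_compact
    hb.isCompact_closure).mono_set subset_closure

/-- The potential in the grounded domain with regular part `g` of the charge `smearDensity c r`,
that is, `2π` times the Green's function with its pole at `c` smeared out over the disc of radius
`r`. -/
noncomputable def smearedGreen (g : ℂ → ℂ → ℝ) (c : ℂ) (r : ℝ) (x : ℂ) : ℝ :=
  smearPotential c r x + 2 * Real.pi * g x c

lemma smearedGreen_of_le {c x : ℂ} {r : ℝ} (hr : 0 < r) (hx : r ≤ ‖x - c‖) :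
    smearedGreen g c r x = 2 * Real.pi * ((2 * Real.pi)⁻¹ * Real.log ‖x - c‖⁻¹ + g x c) := by
  rw [smearedGreen, smearPotential_eq_log hr hx, mul_add,
    mul_inv_cancel_left₀ (mul_ne_zero two_ne_zero Real.pi_ne_zero)]

namespace IsGreenRegularPart

variable (hg : IsGreenRegularPart Ω g) {c x : ℂ} (hc : c ∈ Ω) (r : ℝ)
include hg hc

lemma harmonicAt_two_pi_mul (hx : x ∈ Ω) : HarmonicAt (fun x => 2 * Real.pi * g x c) x :=
  ((hg.harmonic c hc).harmonicOnNhd x hx).const_smul (c := 2 * Real.pi)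

lemma continuousOn_smearedGreen : ContinuousOn (smearedGreen g c r) (closure Ω) :=
  (contDiff_smearPotential c r).continuous.continuousOn.add
    (continuousOn_const.mul (hg.harmonic c hc).continuousOn)

lemma contDiffAt_smearedGreen (hx : x ∈ Ω) : ContDiffAt ℝ 2 (smearedGreen g c r) x :=
  (contDiff_infty.1 (contDiff_smearPotential c r) 2).contDiffAt.add
    (hg.harmonicAt_two_pi_mul hc hx).1

lemma laplacian_smearedGreen (hx : x ∈ Ω) :
    Laplacian.laplacian (smearedGreen g c r) x = -smearDensity c r x := by
  have h_harmonic := hg.harmonicAt_two_pi_mul hc hx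
  have h_regular : Laplacian.laplacian (fun x => 2 * Real.pi * g x c) x = 0 :=
    h_harmonic.2.self_of_nhds
  have h_add := (contDiff_infty.1 (contDiff_smearPotential c r) 2).contDiffAt.laplacian_add
    h_harmonic.1
  rwa [h_regular, add_zero, laplacian_smearPotential] at h_add

omit hc
variable {r}

lemma smearedGreen_eq_zero (hΩ : IsOpen Ω) (hr : 0 < r) (hball : Metric.closedBall c r ⊆ Ω)
    (hx : x ∈ frontier Ω) : smearedGreen g c r x = 0 := by
  have hxr : r ≤ ‖x - c‖ := by
    by_contra! hlt
    exact (hΩ.frontier_eq ▸ hx).2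
      (hball (mem_closedBall_iff_norm.2 hlt.le))
  rw [smearedGreen_of_le hr hxr,
    hg.boundary c (hball (Metric.mem_closedBall_self hr.le)) x hx, add_neg_cancel, mul_zero]

lemma setIntegral_smearedGreen_mul_smearDensity_self (hb : Bornology.IsBounded Ω) (hr : 0 < r)
    (hball : Metric.closedBall c r ⊆ Ω) :
    ∫ x in Ω, smearedGreen g c r x * smearDensity c r x =
      selfEnergy - 2 * Real.pi * Real.log r + (2 * Real.pi) ^ 2 * g c c := by
  have hc : c ∈ Ω := hball (Metric.mem_closedBall_self hr.le)
  have h_regular : IntegrableOn (fun x => 2 * Real.pi * g x c * smearDensity c r x) Ω :=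
    integrableOn_mul_smearDensity hb c r (continuousOn_const.mul (hg.harmonic c hc).continuousOn)
  simp only [smearedGreen, add_mul]
  rw [integral_add (integrableOn_mul_smearDensity hb c r
      (contDiff_smearPotential c r).continuous.continuousOn) h_regular,
    setIntegral_mul_smearDensity hr hball, setIntegral_mul_smearDensity hr hball,
    integral_smearPotential_mul_smearDensity c hr, integral_harmonic_mul_smearDensity hr
      fun x hx => hg.harmonicAt_two_pi_mul hc (hball hx)]
  ring

lemma setIntegral_smearedGreen_mul_smearDensity {c' : ℂ} {r' : ℝ} (hr : 0 < r) (hr' : 0 < r')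
    (hc : c ∈ Ω) (hball' : Metric.closedBall c' r' ⊆ Ω) (hdisj : r + r' < ‖c - c'‖) :
    ∫ x in Ω, smearedGreen g c r x * smearDensity c' r' x =
      (2 * Real.pi) ^ 2 * ((2 * Real.pi)⁻¹ * Real.log ‖c' - c‖⁻¹ + g c' c) := by
  have h_far : ∀ x ∈ Metric.closedBall c' r', r < ‖x - c‖ := by
    intro x hx
    rw [Metric.mem_closedBall, dist_eq_norm] at hx
    have h_triangle := norm_sub_le_norm_sub_add_norm_sub c x c'
    rw [norm_sub_rev c x] at h_triangle
    linarith
  have h_harmonic : HarmonicOnNhd (smearedGreen g c r) (Metric.closedBall c' r') := fun x hx =>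
    (harmonicAt_smearPotential hr (h_far x hx)).add (hg.harmonicAt_two_pi_mul hc (hball' hx))
  rw [setIntegral_mul_smearDensity hr' hball', integral_harmonic_mul_smearDensity hr' h_harmonic,
    smearedGreen_of_le hr (h_far c' (Metric.mem_closedBall_self hr'.le)).le]
  ring

variable {ι : Type*} [Fintype ι] {α : ι → ℝ} {z : ι → ℂ} {ρ : ι → ℝ}

/-- The double sum is the Dirichlet energy of the potential generated by the smeared charges. -/
lemma energy_nonneg (hΩ : IsOpen Ω) (hb : Bornology.IsBounded Ω) (α : ι → ℝ) (hρ : ∀ k, 0 < ρ k)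
    (hball : ∀ k, Metric.closedBall (z k) (ρ k) ⊆ Ω) :
    0 ≤ ∑ k, ∑ l, α k * α l *
      ∫ x in Ω, smearedGreen g (z k) (ρ k) x * smearDensity (z l) (ρ l) x := by
  have hz (k) : z k ∈ Ω := hball k (Metric.mem_closedBall_self (hρ k).le)
  have h_cont (k) := hg.continuousOn_smearedGreen (hz k) (ρ k)
  have h_int (k l) := integrableOn_mul_smearDensity hb (z l) (ρ l) (h_cont k)
  calc 0 ≤ ∫ x in Ω, (∑ k, α k * smearedGreen g (z k) (ρ k) x) *
        ∑ l, α l * smearDensity (z l) (ρ l) x := by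
        refine setIntegral_mul_nonneg_of_laplacian hΩ hb
          (continuousOn_finsetSum _ fun k _ => continuousOn_const.mul (h_cont k))
          (fun x hx => Finset.sum_eq_zero fun k _ => ?_)
          (fun x hx => (ContDiffAt.sum fun k _ => contDiffAt_const.mul
            (hg.contDiffAt_smearedGreen (hz k) (ρ k) hx)).contDiffWithinAt)
          (fun x hx => ?_)
          (continuous_finsetSum _ fun l _ =>
            continuous_const.mul (continuous_smearDensity _ _)).continuousOn
        · rw [hg.smearedGreen_eq_zero hΩ (hρ k) (hball k) hx, mul_zero]
        · rw [laplacian_sum_mul _ _ fun k _ => hg.contDiffAt_smearedGreen (hz k) (ρ k) hx]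
          simp only [hg.laplacian_smearedGreen (hz _) (ρ _) hx, mul_neg, Finset.sum_neg_distrib]
    _ = ∫ x in Ω, ∑ k, ∑ l, α k * α l *
          (smearedGreen g (z k) (ρ k) x * smearDensity (z l) (ρ l) x) := by
        simp only [Finset.sum_mul_sum, mul_mul_mul_comm]
    _ = _ := by
        rw [integral_finsetSum _ fun k _ => integrable_finsetSum _ fun l _ =>
          (h_int k l).const_mul _]
        simp only [integral_finsetSum _ fun l _ => (h_int _ l).const_mul _, integral_const_mul]

/-- Onsager's inequality. -/
lemma neg_sum_sum_Ioi_le [LinearOrder ι] [LocallyFiniteOrderTop ι] [LocallyFiniteOrderBot ι]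
    (hΩ : IsOpen Ω) (hb : Bornology.IsBounded Ω) (α : ι → ℝ) (hρ : ∀ k, 0 < ρ k)
    (hball : ∀ k, Metric.closedBall (z k) (ρ k) ⊆ Ω)
    (hdisj : ∀ k l, k ≠ l → ρ k + ρ l < ‖z k - z l‖) :
    -∑ k, ∑ l ∈ Finset.Ioi k, α k * α l *
        ((2 * Real.pi)⁻¹ * Real.log ‖z k - z l‖⁻¹ + g (z k) (z l)) ≤
      ∑ k, α k ^ 2 / 2 * (selfEnergy / (2 * Real.pi) ^ 2 + g (z k) (z k) -
        (2 * Real.pi)⁻¹ * Real.log (ρ k)) := by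
  have hz (k) : z k ∈ Ω := hball k (Metric.mem_closedBall_self (hρ k).le)
  set Q : ι → ι → ℝ := fun k l => α k * α l *
    ∫ x in Ω, smearedGreen g (z k) (ρ k) x * smearDensity (z l) (ρ l) x with hQ
  have h_offDiag (k l) (hkl : k ≠ l) : Q k l = (2 * Real.pi) ^ 2 *
      (α k * α l * ((2 * Real.pi)⁻¹ * Real.log ‖z k - z l‖⁻¹ + g (z k) (z l))) := by
    simp only [hQ]
    rw [hg.setIntegral_smearedGreen_mul_smearDensity (hρ k) (hρ l) (hz k) (hball l)
      (hdisj k l hkl), norm_sub_rev, hg.symm _ (hz l) _ (hz k)]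
    ring
  have h_diag (k) : Q k k = 2 * (2 * Real.pi) ^ 2 * (α k ^ 2 / 2 *
      (selfEnergy / (2 * Real.pi) ^ 2 + g (z k) (z k) - (2 * Real.pi)⁻¹ * Real.log (ρ k))) := by
    simp only [hQ]
    rw [hg.setIntegral_smearedGreen_mul_smearDensity_self hb (hρ k) (hball k)]
    field_simp
    ring
  have h_symm (k l) : Q k l = Q l k := by
    rcases eq_or_ne k l with rfl | hkl
    · rfl
    · rw [h_offDiag k l hkl, h_offDiag l k hkl.symm, norm_sub_rev, hg.symm _ (hz k) _ (hz l),
        mul_comm (α k)]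
  have h_energy : 0 ≤ ∑ k, ∑ l, Q k l := hg.energy_nonneg hΩ hb α hρ hball
  rw [sum_sum_eq_sum_diag_add_two_mul_sum_Ioi h_symm, Finset.sum_congr rfl fun k _ => h_diag k,
    Finset.sum_congr rfl fun k _ => Finset.sum_congr rfl fun l hl =>
      h_offDiag k l (Finset.mem_Ioi.1 hl).ne] at h_energy
  simp only [← Finset.mul_sum] at h_energy
  have h_pos : 0 < 2 * (2 * Real.pi) ^ 2 := by positivity
  refine neg_le_iff_add_nonneg.2 (nonneg_of_mul_nonneg_right ?_ h_pos)
  linarith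

end IsGreenRegularPart

lemma sq_div_two_mul_sub_log_le {a α A E r : ℝ} (ha : a ^ 2 ≤ 4 * Real.pi) (hα : |α| ≤ a)
    (hA : 0 ≤ A) (hE : E ≤ A) (hr : 0 < r) (hr1 : r ≤ 1) :
    α ^ 2 / 2 * (E - (2 * Real.pi)⁻¹ * Real.log r) ≤
      2 * Real.pi * A + Real.log r * -(a ^ 2 / (4 * Real.pi)) := by
  have hαa : α ^ 2 ≤ a ^ 2 := sq_le_sq.2 (hα.trans (le_abs_self a))
  have h_log : 0 ≤ -Real.log r := neg_nonneg.2 (Real.log_nonpos hr.le hr1)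
  calc α ^ 2 / 2 * (E - (2 * Real.pi)⁻¹ * Real.log r)
      = α ^ 2 / 2 * E + α ^ 2 / (4 * Real.pi) * -Real.log r := by
        field_simp
        ring
    _ ≤ α ^ 2 / 2 * A + α ^ 2 / (4 * Real.pi) * -Real.log r := by gcongr
    _ ≤ 4 * Real.pi / 2 * A + a ^ 2 / (4 * Real.pi) * -Real.log r := by
        gcongr
        exact hαa.trans ha
    _ = _ := by ring

/-- Onsager's inequality as a bound of the Boltzmann weight by a product over the particles. -/
lemma exists_coulombWeight_le (hΩ : IsOpen Ω) (hb : Bornology.IsBounded Ω) {a : ℝ}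
    (ha : a ^ 2 ≤ 4 * Real.pi) :
    ∃ C : ℝ, 1 ≤ C ∧ ∀ (n : ℕ) (α : Fin n → ℝ) (x : Fin n → ℂ) (r : Fin n → ℝ),
      (∀ k, |α k| ≤ a) → (∀ k, 0 < r k) → (∀ k, r k ≤ 1) →
      (∀ k, Metric.closedBall (x k) (r k) ⊆ Ω) →
      (∀ k l, k ≠ l → r k + r l < ‖x k - x l‖) →
      coulombWeight Ω α x ≤ ∏ k, C * r k ^ (-(a ^ 2 / (4 * Real.pi))) := by
  obtain ⟨R, hR⟩ := Metric.isBounded_iff.1 hb.closure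
  set A := |selfEnergy| / (2 * Real.pi) ^ 2 + (2 * Real.pi)⁻¹ * |Real.log R|
  have hA0 : 0 ≤ A := by positivity
  have hC : 1 ≤ Real.exp (2 * Real.pi * A) := Real.one_le_exp (by positivity)
  refine ⟨Real.exp (2 * Real.pi * A), hC, fun n α x r hα hr hr1 hball hdisj => ?_⟩
  by_cases hg : ∃ g, IsGreenRegularPart Ω g
  · have h_diag (k) : selfEnergy / (2 * Real.pi) ^ 2 + hg.choose (x k) (x k) ≤ A := by
      have hxk : x k ∈ Ω := hball k (Metric.mem_closedBall_self (hr k).le)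
      have h_log := hg.choose_spec.le_log hΩ hb
        (fun y hy z hz => (dist_eq_norm y z).symm.trans_le (hR hy hz)) hxk hxk
      refine add_le_add ?_ (h_log.trans ?_) <;> gcongr <;> exact le_abs_self _
    simp only [coulombWeight, greenFunction, dif_pos hg]
    refine (Real.exp_le_exp.2 (hg.choose_spec.neg_sum_sum_Ioi_le hΩ hb α hr hball hdisj)).trans ?_
    rw [Real.exp_sum]
    refine Finset.prod_le_prod (fun k _ => (Real.exp_pos _).le) fun k _ => ?_
    rw [Real.rpow_def_of_pos (hr k), ← Real.exp_add]
    exact Real.exp_le_exp.2 (sq_div_two_mul_sub_log_le ha (hα k) hA0 (h_diag k) (hr k) (hr1 k))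
  · simp only [coulombWeight, greenFunction, dif_neg hg, mul_zero, Finset.sum_const_zero, neg_zero,
      Real.exp_zero]
    exact Finset.one_le_prod fun k _ => one_le_mul_of_one_le_of_one_le hC
      (Real.one_le_rpow_of_pos_of_le_one_of_nonpos (hr k) (hr1 k)
        (neg_nonpos.2 (by positivity)))

end Onsager

section TwoFixedPoints

variable {E : Type*} {m : ℕ} {x₁ x₂ : E}

lemma cons_cons_mem {L : Set E} (h₁ : x₁ ∈ L) (h₂ : x₂ ∈ L) {y : Fin m → E}
    (hy : ∀ j, y j ∈ L) (k : Fin (m + 2)) : (Fin.cons x₁ (Fin.cons x₂ y) : Fin (m + 2) → E) k ∈ L :=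
  Fin.cases h₁ (Fin.cases h₂ hy) k

lemma cons_cons_comp_succ_succ {x : Fin (m + 2) → E} (h₁ : x 0 = x₁) (h₂ : x 1 = x₂) :
    Fin.cons x₁ (Fin.cons x₂ fun j : Fin m => x j.succ.succ) = x :=
  funext (Fin.cases h₁.symm (Fin.cases h₂.symm fun _ => rfl))

variable [MeasurableSpace E]

lemma measurable_cons_cons (x₁ x₂ : E) :
    Measurable fun y : Fin m → E => (Fin.cons x₁ (Fin.cons x₂ y) : Fin (m + 2) → E) :=
  measurable_pi_iff.2
    (Fin.cases measurable_const (Fin.cases measurable_const measurable_pi_apply))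

lemma lintegral_cons_cons {ν : Measure E} [SigmaFinite ν] {Φ : (Fin (m + 2) → E) → ℝ≥0∞}
    (hΦ : Measurable Φ) (x₁ x₂ : E) (y₀ : Fin m → E) :
    ∫⁻ y, Φ (Fin.cons x₁ (Fin.cons x₂ y)) ∂Measure.pi (fun _ => ν) =
      lmarginal (fun _ => ν) (Finset.univ \ {0, 1}) Φ (Fin.cons x₁ (Fin.cons x₂ y₀)) := by
  have h_inj : Function.Injective fun j : Fin m => j.succ.succ :=
    (Fin.succ_injective _).comp (Fin.succ_injective _)
  have h_image : Finset.univ.image (fun j : Fin m => j.succ.succ) = Finset.univ \ {0, 1} := by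
    ext k
    refine Fin.cases ?_ (Fin.cases ?_ fun j => ?_) k <;> simp [Fin.ext_iff]
  have h_marginal := lmarginal_image (μ := fun _ : Fin (m + 2) => ν) h_inj Finset.univ
    (hΦ.comp (measurable_cons_cons x₁ x₂)) (Fin.cons x₁ (Fin.cons x₂ y₀))
  rw [lmarginal_univ, h_image] at h_marginal
  refine h_marginal.symm.trans (lintegral_congr fun z => ?_)
  exact congrArg Φ (cons_cons_comp_succ_succ
    (by simp [Function.updateFinset]) (by simp [Function.updateFinset]))

end TwoFixedPoints

section CoulombWeight

variable {Ω : Set ℂ}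

lemma exists_measurable_eq_greenFunction (hΩ : IsOpen Ω) :
    ∃ G : ℂ × ℂ → ℝ, Measurable G ∧ ∀ x ∈ Ω, ∀ y ∈ Ω, G (x, y) = greenFunction Ω x y := by
  by_cases hg : ∃ g, IsGreenRegularPart Ω g
  swap
  · exact ⟨fun _ => 0, measurable_const, fun x _ y _ => by rw [greenFunction, dif_neg hg]⟩
  set g := hg.choose
  have h_left (y : Ω) : Continuous fun x : Ω => g x y :=
    ((hg.choose_spec.harmonic y y.2).continuousOn.mono subset_closure).domRestrict
  have h_right (x : Ω) : Continuous fun y : Ω => g x y :=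
    (h_left x).congr fun y => hg.choose_spec.symm _ y.2 _ x.2
  have h_meas : Measurable (Function.uncurry fun x y : Ω => g x y) :=
    measurable_uncurry_of_continuous_of_measurable h_left fun x => (h_right x).measurable
  have h_coe : MeasurableEmbedding (Prod.map ((↑) : Ω → ℂ) ((↑) : Ω → ℂ)) :=
    (MeasurableEmbedding.subtype_coe hΩ.measurableSet).prodMap
      (MeasurableEmbedding.subtype_coe hΩ.measurableSet)
  refine ⟨fun p => (2 * Real.pi)⁻¹ * Real.log ‖p.1 - p.2‖⁻¹ +
    Function.extend (Prod.map (↑) (↑)) (Function.uncurry fun x y : Ω => g x y) 0 p,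
    Measurable.add (by fun_prop) (h_coe.measurable_extend h_meas measurable_const),
    fun x hx y hy => ?_⟩
  have h_extend := h_coe.injective.extend_apply (Function.uncurry fun x y : Ω => g x y) 0
    (⟨x, hx⟩, ⟨y, hy⟩)
  rw [greenFunction, dif_pos hg]
  exact congrArg _ h_extend

lemma exists_measurable_eq_coulombWeight (hΩ : IsOpen Ω) {n : ℕ} (α : Fin n → ℝ) :
    ∃ w : (Fin n → ℂ) → ℝ, Measurable w ∧ ∀ x, (∀ k, x k ∈ Ω) → w x = coulombWeight Ω α x := by
  obtain ⟨G, hG, hG_eq⟩ := exists_measurable_eq_greenFunction hΩ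
  refine ⟨fun x => Real.exp (-∑ k, ∑ l ∈ Finset.Ioi k, α k * α l * G (x k, x l)), ?_,
    fun x hx => ?_⟩
  · fun_prop
  · simp only [coulombWeight, hG_eq _ (hx _) _ (hx _)]

lemma coulombWeight_of_forall_eq_zero {n : ℕ} {α : Fin n → ℝ} (hα : ∀ k, α k = 0)
    (x : Fin n → ℂ) : coulombWeight Ω α x = 1 := by
  simp only [coulombWeight, hα, zero_mul, Finset.sum_const_zero, neg_zero, Real.exp_zero]

lemma nearestDist_ne_top {ι E : Type*} [DecidableEq ι] [Fintype ι] [Nontrivial ι]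
    [PseudoMetricSpace E] (x : ι → E) (k : ι) : nearestDist Finset.univ x k ≠ ⊤ := by
  obtain ⟨l, hl⟩ := exists_ne k
  exact ne_top_of_le_ne_top (edist_ne_top _ _) (nearestDist_le (Finset.mem_univ l) hl)

lemma nearestDist_ne_zero {ι E : Type*} [DecidableEq ι] {A : Finset ι} [EMetricSpace E]
    {x : ι → E} (hx : Function.Injective x) (k : ι) : nearestDist A x k ≠ 0 := by
  intro h
  obtain ⟨l, -, hlk, hl⟩ := exists_nearestDist_eq (h.trans_ne ENNReal.zero_ne_top)
  exact hlk (hx (edist_eq_zero.1 (hl.symm.trans h))).symm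

lemma one_le_max_one_rpow {β : ℝ} (hβ : 0 ≤ β) (d : ℝ≥0∞) : 1 ≤ max 1 d ^ β :=
  (ENNReal.one_rpow β).symm.trans_le (ENNReal.rpow_le_rpow (le_max_left _ _) hβ)

lemma prod_max_nearestDist_eq_top {ι E : Type*} [DecidableEq ι] [Fintype ι] [PseudoEMetricSpace E]
    {x : ι → E} (hx : ¬Function.Injective x) {s : ℝ≥0∞} (hs : s ≠ 0) {β : ℝ} (hβ : 0 < β) :
    ∏ k, max 1 (s / nearestDist Finset.univ x k) ^ β = ⊤ := by
  obtain ⟨k, l, hkl, hne⟩ := Function.not_injective_iff.1 hx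
  have h_zero : nearestDist Finset.univ x k = 0 :=
    le_antisymm ((nearestDist_le (Finset.mem_univ l) hne.symm).trans_eq (by rw [hkl, edist_self]))
      zero_le
  have h_top : max 1 (s / nearestDist Finset.univ x k) ^ β = ⊤ := by
    rw [h_zero, ENNReal.div_zero hs, max_eq_right le_top, ENNReal.top_rpow_of_pos hβ]
  exact top_unique (h_top.symm.trans_le (Finset.single_le_prod'
    (f := fun k => max 1 (s / nearestDist Finset.univ x k) ^ β)
    (fun k _ => one_le_max_one_rpow hβ.le _) (Finset.mem_univ k)))

lemma min_div_three_rpow_neg_le {D s δ β : ℝ} (hD : 0 < D) (hs : 0 < s) (hs1 : s ≤ 1) (hδ : 0 < δ)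
    (hδ1 : δ ≤ 1) (hβ : 0 ≤ β) :
    min (D / 3) δ ^ (-β) ≤ (3 / δ) ^ β * s ^ (-β) * max 1 (s / D) ^ β := by
  set w := max 1 (s / D)
  have hw1 : 1 ≤ w := le_max_left _ _
  have hw0 : 0 < w := one_pos.trans_le hw1
  have h_lower : δ * s / 3 / w ≤ min (D / 3) δ := by
    refine le_min ?_ ?_ <;> rw [div_le_iff₀ hw0]
    · have hsw : s ≤ w * D := (div_le_iff₀ hD).1 (le_max_right 1 (s / D))
      linarith [mul_le_of_le_one_left hs.le hδ1]
    · linarith [mul_le_of_le_one_right hδ.le hs1, le_mul_of_one_le_right hδ.le hw1,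
        mul_pos hδ hs]
  calc min (D / 3) δ ^ (-β) ≤ (δ * s / 3 / w) ^ (-β) :=
        Real.rpow_le_rpow_of_nonpos (by positivity) h_lower (neg_nonpos.2 hβ)
    _ = ((3 / δ)⁻¹ * s * w⁻¹) ^ (-β) := by
        congr 1
        field_simp
    _ = (3 / δ) ^ β * s ^ (-β) * w ^ β := by
        rw [Real.mul_rpow (by positivity) (by positivity),
          Real.mul_rpow (by positivity) (by positivity), Real.rpow_neg_eq_inv_rpow (3 / δ)⁻¹,
          inv_inv, Real.rpow_neg_eq_inv_rpow w⁻¹, inv_inv]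

lemma ofReal_max_one_div_toReal_rpow {D : ℝ≥0∞} (hD0 : D ≠ 0) (hD : D ≠ ⊤) (s β : ℝ) :
    ENNReal.ofReal (max 1 (s / D.toReal) ^ β) = max 1 (ENNReal.ofReal s / D) ^ β := by
  rw [← ENNReal.ofReal_rpow_of_pos (by positivity), ENNReal.ofReal_max, ENNReal.ofReal_one,
    ENNReal.ofReal_div_of_pos (ENNReal.toReal_pos hD0 hD), ENNReal.ofReal_toReal hD]

/-- Onsager's inequality with radii proportional to the nearest neighbour distances, but bounded by
the distance of `L` to the boundary. -/
lemma exists_coulombWeight_le_prod_max_of_injective (hΩ : IsOpen Ω) (hb : Bornology.IsBounded Ω)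
    {a : ℝ} (ha : a ^ 2 ≤ 4 * Real.pi) {L : Set ℂ} (hL : IsCompact L) (hLΩ : L ⊆ Ω) :
    ∃ C : ℝ, 1 ≤ C ∧ ∀ (n : ℕ) [Nontrivial (Fin n)] (α : Fin n → ℝ) (x : Fin n → ℂ) (s : ℝ),
      (∀ k, |α k| ≤ a) → (∀ k, x k ∈ L) → 0 < s → s ≤ 1 → Function.Injective x →
      ENNReal.ofReal (coulombWeight Ω α x) ≤
        ENNReal.ofReal (C * s ^ (-(a ^ 2 / (4 * Real.pi)))) ^ n *
          ∏ k, max 1 (ENNReal.ofReal s / nearestDist Finset.univ x k) ^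
            (a ^ 2 / (4 * Real.pi)) := by
  obtain ⟨C, hC, h_onsager⟩ := exists_coulombWeight_le hΩ hb ha
  obtain ⟨δ₀, hδ₀, h_thickening⟩ := hL.exists_cthickening_subset_open hΩ hLΩ
  set δ := min δ₀ 1
  set β := a ^ 2 / (4 * Real.pi)
  have hβ : 0 ≤ β := by positivity
  have hδ : 0 < δ := lt_min hδ₀ one_pos
  have hδ1 : δ ≤ 1 := min_le_right _ _
  refine ⟨C * (3 / δ) ^ β, one_le_mul_of_one_le_of_one_le hC (Real.one_le_rpow
    ((one_le_div hδ).2 (by linarith)) hβ), fun n _ α x s hα hx hs hs1 hinj => ?_⟩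
  set D : Fin n → ℝ≥0∞ := nearestDist Finset.univ x
  have hD0 (k) : D k ≠ 0 := nearestDist_ne_zero hinj k
  have hD_top (k) : D k ≠ ⊤ := nearestDist_ne_top x k
  have hD_pos (k) : 0 < (D k).toReal := ENNReal.toReal_pos (hD0 k) (hD_top k)
  have hD_le (k l) (hkl : k ≠ l) : (D k).toReal ≤ ‖x k - x l‖ := by
    rw [← dist_eq_norm, dist_edist]
    exact ENNReal.toReal_mono (edist_ne_top _ _) (nearestDist_le (Finset.mem_univ l) hkl.symm)
  have h_ball (k) : Metric.closedBall (x k) (min ((D k).toReal / 3) δ) ⊆ Ω :=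
    (Metric.closedBall_subset_closedBall ((min_le_right _ _).trans (min_le_left _ _))).trans
      ((Metric.closedBall_subset_cthickening (hx k) δ₀).trans h_thickening)
  have h_disjoint (k l) (hkl : k ≠ l) :
      min ((D k).toReal / 3) δ + min ((D l).toReal / 3) δ < ‖x k - x l‖ := by
    have h_swap := (hD_le l k hkl.symm).trans_eq (norm_sub_rev _ _)
    linarith [min_le_left ((D k).toReal / 3) δ, min_le_left ((D l).toReal / 3) δ, hD_le k l hkl,
      hD_pos k]
  calc ENNReal.ofReal (coulombWeight Ω α x)
      ≤ ENNReal.ofReal (∏ k, C * min ((D k).toReal / 3) δ ^ (-β)) :=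
        ENNReal.ofReal_le_ofReal (h_onsager n α x _ hα
          (fun k => lt_min (div_pos (hD_pos k) three_pos) hδ)
          (fun k => (min_le_right _ _).trans hδ1) h_ball h_disjoint)
    _ ≤ ENNReal.ofReal (∏ k, C * (3 / δ) ^ β * s ^ (-β) * max 1 (s / (D k).toReal) ^ β) := by
        refine ENNReal.ofReal_le_ofReal (Finset.prod_le_prod (fun k _ => ?_) fun k _ => ?_)
        · positivity
        · simpa only [mul_assoc] using mul_le_mul_of_nonneg_left
            (min_div_three_rpow_neg_le (hD_pos k) hs hs1 hδ hδ1 hβ) (zero_le_one.trans hC)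
    _ = _ := by
        rw [Finset.prod_mul_distrib, Finset.prod_const, Finset.card_fin,
          ENNReal.ofReal_mul (by positivity), ENNReal.ofReal_pow (by positivity),
          ENNReal.ofReal_prod_of_nonneg fun k _ => by positivity]
        simp only [ofReal_max_one_div_toReal_rpow (hD0 _) (hD_top _)]

lemma exists_coulombWeight_le_prod_max (hΩ : IsOpen Ω) (hb : Bornology.IsBounded Ω) {a : ℝ}
    (ha : a ^ 2 ≤ 4 * Real.pi) {L : Set ℂ} (hL : IsCompact L) (hLΩ : L ⊆ Ω) :
    ∃ C : ℝ, 1 ≤ C ∧ ∀ (n : ℕ) [Nontrivial (Fin n)] (α : Fin n → ℝ) (x : Fin n → ℂ) (s : ℝ),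
      (∀ k, |α k| ≤ a) → (∀ k, x k ∈ L) → 0 < s → s ≤ 1 →
      ENNReal.ofReal (coulombWeight Ω α x) ≤
        ENNReal.ofReal (C * s ^ (-(a ^ 2 / (4 * Real.pi)))) ^ n *
          ∏ k, max 1 (ENNReal.ofReal s / nearestDist Finset.univ x k) ^
            (a ^ 2 / (4 * Real.pi)) := by
  obtain ⟨C, hC, h_inj⟩ := exists_coulombWeight_le_prod_max_of_injective hΩ hb ha hL hLΩ
  refine ⟨C, hC, fun n _ α x s hα hx hs hs1 => ?_⟩
  by_cases hx_inj : Function.Injective x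
  · exact h_inj n α x s hα hx hs hs1 hx_inj
  have h_const : 1 ≤ ENNReal.ofReal (C * s ^ (-(a ^ 2 / (4 * Real.pi)))) ^ n :=
    one_le_pow₀ (ENNReal.one_le_ofReal.2 (one_le_mul_of_one_le_of_one_le hC
      (Real.one_le_rpow_of_pos_of_le_one_of_nonpos hs hs1 (neg_nonpos.2 (by positivity)))))
  rcases eq_or_ne a 0 with rfl | ha0
  · rw [coulombWeight_of_forall_eq_zero fun k => abs_nonpos_iff.1 (hα k), ENNReal.ofReal_one]
    exact one_le_mul h_const (Finset.one_le_prod' fun k _ => one_le_max_one_rpow (by positivity) _)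
  · rw [prod_max_nearestDist_eq_top hx_inj (ENNReal.ofReal_pos.2 hs).ne' (by positivity),
      ENNReal.mul_top (zero_lt_one.trans_le h_const).ne']
    exact le_top

end CoulombWeight

section TwoPointFunction

variable {Ω : Set ℂ} {m : ℕ}

lemma enorm_coulombIntegrand (α : Fin (m + 2) → ℝ) (f : Fin m → ℂ → ℂ) (x₁ x₂ : ℂ)
    (y : Fin m → ℂ) : ‖coulombIntegrand Ω α f x₁ x₂ y‖ₑ =
      (∏ j, ‖f j (y j)‖ₑ) * ENNReal.ofReal (coulombWeight Ω α (Fin.cons x₁ (Fin.cons x₂ y))) := by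
  have h_weight : 0 ≤ coulombWeight Ω α (Fin.cons x₁ (Fin.cons x₂ y)) := (Real.exp_pos _).le
  rw [coulombIntegrand, enorm_mul, ← ofReal_norm (Complex.ofReal _), Complex.norm_real,
    Real.norm_of_nonneg h_weight]
  simp only [enorm_eq_nnnorm, nnnorm_prod, ENNReal.ofNNReal_finsetProd]

lemma aestronglyMeasurable_coulombIntegrand (hΩ : IsOpen Ω) (α : Fin (m + 2) → ℝ)
    {f : Fin m → ℂ → ℂ} (hf : ∀ j, AEStronglyMeasurable (f j) (volume.restrict Ω)) {x₁ x₂ : ℂ}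
    (h₁ : x₁ ∈ Ω) (h₂ : x₂ ∈ Ω) :
    AEStronglyMeasurable (coulombIntegrand Ω α f x₁ x₂)
      (volume.restrict (Set.univ.pi fun _ => Ω)) := by
  have h_prod : AEStronglyMeasurable (fun y : Fin m → ℂ => ∏ j, f j (y j))
      (volume.restrict (Set.univ.pi fun _ => Ω)) := by
    rw [volume_pi, Measure.restrict_pi_pi]
    exact Finset.aestronglyMeasurable_fun_prod _ fun j _ =>
      (hf j).comp_quasiMeasurePreserving (Measure.quasiMeasurePreserving_eval _ j)
  obtain ⟨w, hw, hw_eq⟩ := exists_measurable_eq_coulombWeight hΩ α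
  refine (h_prod.mul (Complex.measurable_ofReal.comp
    (hw.comp (measurable_cons_cons x₁ x₂))).aestronglyMeasurable).congr ?_
  filter_upwards [ae_restrict_mem (MeasurableSet.univ_pi fun _ => hΩ.measurableSet)] with y hy
  exact congrArg (fun t : ℝ => (∏ j, f j (y j)) * (t : ℂ))
    (hw_eq _ (cons_cons_mem h₁ h₂ fun j => hy j trivial))

lemma enorm_coulombIntegrand_le {α : Fin (m + 2) → ℝ} {f : Fin m → ℂ → ℂ} {L : Set ℂ} {M : ℝ≥0∞}
    {W : (Fin (m + 2) → ℂ) → ℝ≥0∞} {x₁ x₂ : ℂ} {y : Fin m → ℂ}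
    (hW : ∀ x, (∀ k, x k ∈ L) → ENNReal.ofReal (coulombWeight Ω α x) ≤ W x)
    (hfL : ∀ j, tsupport (f j) ⊆ L) (hM : ∀ j, ‖f j (y j)‖ₑ ≤ M) (h₁ : x₁ ∈ L) (h₂ : x₂ ∈ L) :
    ‖coulombIntegrand Ω α f x₁ x₂ y‖ₑ ≤ M ^ m * W (Fin.cons x₁ (Fin.cons x₂ y)) := by
  rw [enorm_coulombIntegrand]
  by_cases hy : ∀ j, y j ∈ L
  · have h_prod : ∏ j, ‖f j (y j)‖ₑ ≤ M ^ m := by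
      simpa only [Finset.card_fin] using Finset.prod_le_pow_card Finset.univ _ M fun j _ => hM j
    exact mul_le_mul' h_prod (hW _ (cons_cons_mem h₁ h₂ hy))
  · obtain ⟨j, hj⟩ := not_forall.1 hy
    have h_zero : f j (y j) = 0 := image_eq_zero_of_notMem_tsupport fun h => hj (hfL j h)
    rw [Finset.prod_eq_zero (Finset.mem_univ j) (by rw [h_zero, enorm_zero]), zero_mul]
    exact zero_le

lemma inv_sqrt_rpow_neg {t : ℝ} (ht : 0 ≤ t) (β : ℝ) : (√t)⁻¹ ^ (-β) = t ^ (β / 2) := by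
  rw [Real.rpow_neg_eq_inv_rpow, inv_inv, Real.sqrt_eq_rpow, ← Real.rpow_mul ht, one_div_mul_eq_div]

lemma lintegral_prod_max_nearestDist_le {ν : Measure ℂ} [SigmaFinite ν] (hν : ν ≤ volume) {β : ℝ}
    (hβ : 0 ≤ β) (hβ1 : β < 1) (m : ℕ) (x₁ x₂ : ℂ) :
    ∫⁻ y, ∏ k, max 1 (ENNReal.ofReal (√(m + 2 : ℕ))⁻¹ / nearestDist Finset.univ
        (Fin.cons x₁ (Fin.cons x₂ y) : Fin (m + 2) → ℂ) k) ^ β ∂Measure.pi (fun _ : Fin m => ν) ≤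
      (2 * max 1 (ν Set.univ) * ENNReal.ofReal (recursionConst β) *
        ENNReal.ofReal (Real.exp 1)) ^ (m + 2) * pairFactor (2 * β) (edist x₁ x₂) := by
  set s := (√(m + 2 : ℕ))⁻¹
  have hn : (0 : ℝ) < (m + 2 : ℕ) := by positivity
  have hs : 0 < s := inv_pos.2 (Real.sqrt_pos.2 hn)
  have hs1 : s ≤ 1 := inv_le_one_of_one_le₀ (Real.one_le_sqrt.2 (Nat.one_le_cast.2 (by lia)))
  have hns : (Fintype.card (Fin (m + 2)) : ℝ) * s ^ 2 = 1 := by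
    rw [Fintype.card_fin, inv_pow, Real.sq_sqrt hn.le, mul_inv_cancel₀ hn.ne']
  have h_meas : Measurable fun x : Fin (m + 2) → ℂ =>
      ∏ k, max 1 (ENNReal.ofReal s / nearestDist Finset.univ x k) ^ β :=
    Finset.measurable_fun_prod _ fun k _ =>
      (measurable_const.max (measurable_const.div (measurable_nearestDist _ k))).pow_const _
  rw [lintegral_cons_cons h_meas x₁ x₂ 0]
  have h_bound := lmarginal_prod_max_le hν hs hs1 hβ hβ1 hns zero_ne_one
    (Fin.cons x₁ (Fin.cons x₂ 0) : Fin (m + 2) → ℂ)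
  rw [Fintype.card_fin] at h_bound
  exact h_bound

lemma exists_lintegral_coulombIntegrand_le (hΩ : IsOpen Ω) (hb : Bornology.IsBounded Ω) {a : ℝ}
    (ha : a ^ 2 < 4 * Real.pi) {L : Set ℂ} (hL : IsCompact L) (hLΩ : L ⊆ Ω) {M : ℝ≥0∞}
    (hM : M ≠ ⊤) :
    ∃ B : ℝ≥0∞, B ≠ ⊤ ∧ ∀ (m : ℕ) (α : Fin (m + 2) → ℝ) (f : Fin m → ℂ → ℂ), (∀ k, |α k| ≤ a) →
      (∀ j, tsupport (f j) ⊆ L) → (∀ j, eLpNorm (f j) ∞ (volume.restrict Ω) ≤ M) →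
      ∀ x₁ ∈ L, ∀ x₂ ∈ L,
      ∫⁻ y in Set.univ.pi fun _ => Ω, ‖coulombIntegrand Ω α f x₁ x₂ y‖ₑ ≤
        (B * ENNReal.ofReal (((m + 2 : ℕ) : ℝ) ^ (a ^ 2 / (8 * Real.pi)))) ^ (m + 2) *
          pairFactor (a ^ 2 / (2 * Real.pi)) (edist x₁ x₂) := by
  obtain ⟨C, hC, h_weight⟩ := exists_coulombWeight_le_prod_max hΩ hb ha.le hL hLΩ
  obtain ⟨β, hβ_def⟩ : ∃ β, β = a ^ 2 / (4 * Real.pi) := ⟨_, rfl⟩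
  have h_half : a ^ 2 / (8 * Real.pi) = β / 2 := by rw [hβ_def]; ring
  have h_two : a ^ 2 / (2 * Real.pi) = 2 * β := by rw [hβ_def]; ring
  have hβ : 0 ≤ β := hβ_def ▸ by positivity
  have hβ1 : β < 1 := hβ_def ▸ (div_lt_one (by positivity)).2 ha
  rw [h_half, h_two]
  rw [← hβ_def] at h_weight
  set ν : Measure ℂ := volume.restrict Ω
  have : IsFiniteMeasure ν := isFiniteMeasure_restrict.2 hb.measure_lt_top.ne
  set R : ℝ≥0∞ :=
    2 * max 1 (ν Set.univ) * ENNReal.ofReal (recursionConst β) * ENNReal.ofReal (Real.exp 1)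
  refine ⟨max 1 M * ENNReal.ofReal C * R, by finiteness,
    fun m α f hα hfL hfM x₁ h₁ x₂ h₂ => ?_⟩
  rw [volume_pi, Measure.restrict_pi_pi]
  set s := (√(m + 2 : ℕ))⁻¹
  have hs : 0 < s := by positivity
  have hs1 : s ≤ 1 := inv_le_one_of_one_le₀ (Real.one_le_sqrt.2 (Nat.one_le_cast.2 (by lia)))
  set W := ENNReal.ofReal (C * s ^ (-β)) ^ (m + 2)
  calc ∫⁻ y, ‖coulombIntegrand Ω α f x₁ x₂ y‖ₑ ∂Measure.pi (fun _ => ν)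
      ≤ ∫⁻ y, M ^ m * (W * ∏ k, max 1 (ENNReal.ofReal s / nearestDist Finset.univ
          (Fin.cons x₁ (Fin.cons x₂ y) : Fin (m + 2) → ℂ) k) ^ β) ∂Measure.pi (fun _ => ν) := by
        refine lintegral_mono_ae ?_
        filter_upwards [ae_all_iff.2 fun j => (Measure.quasiMeasurePreserving_eval _ j).ae
          (enorm_ae_le_eLpNormEssSup (f j) ν)] with y hy
        exact enorm_coulombIntegrand_le (fun x hx => h_weight (m + 2) α x s hα hx hs hs1) hfL
          (fun j => (hy j).trans (eLpNorm_exponent_top.symm.trans_le (hfM j))) h₁ h₂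
    _ ≤ M ^ m * W * (R ^ (m + 2) * pairFactor (2 * β) (edist x₁ x₂)) := by
        rw [lintegral_const_mul' _ _ (by finiteness), lintegral_const_mul' _ _ (by finiteness),
          ← mul_assoc]
        exact mul_le_mul' le_rfl
          (lintegral_prod_max_nearestDist_le Measure.restrict_le_self hβ hβ1 m x₁ x₂)
    _ ≤ max 1 M ^ (m + 2) * W * (R ^ (m + 2) * pairFactor (2 * β) (edist x₁ x₂)) := by
        gcongr ?_ * _ * _
        calc M ^ m ≤ max 1 M ^ m := pow_le_pow_left' (le_max_right _ _) m
          _ ≤ max 1 M ^ (m + 2) := pow_le_pow_right₀ (le_max_left _ _) (by lia)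
    _ = _ := by
        simp only [W, s, inv_sqrt_rpow_neg (Nat.cast_nonneg (m + 2)),
          ENNReal.ofReal_mul (zero_le_one.trans hC), mul_pow]
        ring

lemma pairFactor_edist_le {γ r : ℝ} (hγ : 0 ≤ γ) {x y : ℂ} (hxy : x ≠ y) (hr : ‖x - y‖ ≤ r) :
    pairFactor γ (edist x y) ≤ ENNReal.ofReal ((1 + r ^ γ) * ‖x - y‖ ^ (-γ)) := by
  have hd : 0 < ‖x - y‖ := norm_pos_iff.2 (sub_ne_zero.2 hxy)
  have h_one : 1 ≤ r ^ γ * ‖x - y‖ ^ (-γ) :=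
    calc 1 = ‖x - y‖ ^ γ * ‖x - y‖ ^ (-γ) := by
          rw [← Real.rpow_add hd, add_neg_cancel, Real.rpow_zero]
      _ ≤ _ := by gcongr
  rw [pairFactor, edist_dist, dist_eq_norm, one_div, ← ENNReal.ofReal_inv_of_pos hd,
    ENNReal.ofReal_rpow_of_pos (inv_pos.2 hd), ← Real.rpow_neg_eq_inv_rpow,
    ← ENNReal.ofReal_one, ← ENNReal.ofReal_add zero_le_one (by positivity)]
  exact ENNReal.ofReal_le_ofReal (by linarith)

lemma mul_rpow_pow_mul_le {b D d : ℝ} (hb : 0 ≤ b) (hD : 1 ≤ D) (hd : 0 ≤ d) (κ : ℝ) {n : ℕ}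
    (hn : n ≠ 0) :
    (b * (n : ℝ) ^ κ) ^ n * (D * d) ≤ d * ((b + 1) * D) ^ n * (n : ℝ) ^ (κ * n) :=
  calc (b * (n : ℝ) ^ κ) ^ n * (D * d) = d * (b ^ n * D) * (n : ℝ) ^ (κ * n) := by
        rw [mul_pow, Real.rpow_mul_natCast n.cast_nonneg]
        ring
    _ ≤ d * ((b + 1) ^ n * D ^ n) * (n : ℝ) ^ (κ * n) := by
        gcongr
        · exact le_add_of_nonneg_right zero_le_one
        · exact le_self_pow₀ hD hn
    _ = _ := by rw [mul_pow]

lemma exists_coulombTwoPoint_le (hΩ : IsOpen Ω) (hb : Bornology.IsBounded Ω) {a : ℝ}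
    (ha : a ^ 2 < 4 * Real.pi) {L : Set ℂ} (hL : IsCompact L) (hLΩ : L ⊆ Ω) {M : ℝ≥0∞}
    (hM : M ≠ ⊤) :
    ∃ C : ℝ, 0 < C ∧ ∀ (m : ℕ) (α : Fin (m + 2) → ℝ) (f : Fin m → ℂ → ℂ), (∀ k, |α k| ≤ a) →
      (∀ j, AEStronglyMeasurable (f j) (volume.restrict Ω)) → (∀ j, tsupport (f j) ⊆ L) →
      (∀ j, eLpNorm (f j) ∞ (volume.restrict Ω) ≤ M) → ∀ x₁ ∈ L, ∀ x₂ ∈ L, x₁ ≠ x₂ →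
        IntegrableOn (coulombIntegrand Ω α f x₁ x₂) (Set.univ.pi fun _ => Ω) ∧
        ‖coulombTwoPoint Ω α f x₁ x₂‖ ≤
          ‖x₁ - x₂‖ ^ (-(a ^ 2 / (2 * Real.pi))) * C ^ (m + 2) *
            ((m + 2 : ℕ) : ℝ) ^ (a ^ 2 / (8 * Real.pi) * ((m + 2 : ℕ) : ℝ)) := by
  obtain ⟨B, hB, h_lintegral⟩ := exists_lintegral_coulombIntegrand_le hΩ hb ha hL hLΩ hM
  set γ := a ^ 2 / (2 * Real.pi)
  set κ := a ^ 2 / (8 * Real.pi)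
  set D := 1 + Metric.diam Ω ^ γ
  have hD : 1 ≤ D := le_add_of_nonneg_right (Real.rpow_nonneg Metric.diam_nonneg _)
  refine ⟨(B.toReal + 1) * D, by positivity, fun m α f hα hf hfL hfM x₁ h₁ x₂ h₂ hne => ?_⟩
  have h_diam : ‖x₁ - x₂‖ ≤ Metric.diam Ω :=
    (dist_eq_norm x₁ x₂).symm.trans_le (Metric.dist_le_diam_of_mem hb (hLΩ h₁) (hLΩ h₂))
  have h_pair := pairFactor_edist_le (γ := γ) (by positivity) hne h_diam
  have h_enorm : ∫⁻ y in Set.univ.pi fun _ => Ω, ‖coulombIntegrand Ω α f x₁ x₂ y‖ₑ ≤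
      ENNReal.ofReal (‖x₁ - x₂‖ ^ (-γ) * ((B.toReal + 1) * D) ^ (m + 2) *
        ((m + 2 : ℕ) : ℝ) ^ (κ * (m + 2 : ℕ))) :=
    calc ∫⁻ y in Set.univ.pi fun _ => Ω, ‖coulombIntegrand Ω α f x₁ x₂ y‖ₑ
        ≤ (B * ENNReal.ofReal (((m + 2 : ℕ) : ℝ) ^ κ)) ^ (m + 2) * pairFactor γ (edist x₁ x₂) :=
          h_lintegral m α f hα hfL hfM x₁ h₁ x₂ h₂
      _ ≤ ENNReal.ofReal
          ((B.toReal * ((m + 2 : ℕ) : ℝ) ^ κ) ^ (m + 2) * (D * ‖x₁ - x₂‖ ^ (-γ))) := by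
          rw [ENNReal.ofReal_mul (by positivity), ENNReal.ofReal_pow (by positivity),
            ENNReal.ofReal_mul ENNReal.toReal_nonneg, ENNReal.ofReal_toReal hB]
          exact mul_le_mul' le_rfl h_pair
      _ ≤ _ := ENNReal.ofReal_le_ofReal
          (mul_rpow_pow_mul_le ENNReal.toReal_nonneg hD (by positivity) κ (by lia))
  refine ⟨⟨aestronglyMeasurable_coulombIntegrand hΩ α hf (hLΩ h₁) (hLΩ h₂),
    h_enorm.trans_lt ENNReal.ofReal_lt_top⟩, ?_⟩
  rw [← ENNReal.ofReal_le_ofReal_iff (by positivity), ofReal_norm]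
  exact (enorm_integral_le_lintegral_enorm _).trans h_enorm

lemma sq_norm_lt_of_mem_Ioo_sqrt {ι : Type*} [Fintype ι] {α : ι → ℝ} {b : ℝ} (hb : 0 < b)
    (hα : ∀ i, α i ∈ Set.Ioo (-√b) √b) : ‖α‖ ^ 2 < b :=
  (Real.lt_sqrt (norm_nonneg α)).1
    ((pi_norm_lt_iff (Real.sqrt_pos.2 hb)).2 fun i => abs_lt.2 (hα i))

end TwoPointFunction

theorem proposition3p7_general (Ω : Set ℂ) (hΩ : IsOpen Ω) (hΩb : Bornology.IsBounded Ω)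
    (K : Set ℂ) (hK : IsCompact K) (hKΩ : K ⊆ Ω) (a : ℝ) (S : Set ℂ) (M : ℝ≥0∞) :
    ∃ C : ℝ, 0 < C ∧ ∀ (m : ℕ) (α : Fin (m + 2) → ℝ) (f : Fin m → ℂ → ℂ),
      (∀ i, α i ∈ Set.Ioo (-√(4 * Real.pi)) √(4 * Real.pi)) → ‖α‖ = a →
      (∀ j, MemLp (f j) ∞ (volume.restrict Ω) ∧ HasCompactSupport (f j) ∧ tsupport (f j) ⊆ Ω) →
      (⋃ j, tsupport (f j)) = S → (⨆ j, eLpNorm (f j) ∞ (volume.restrict Ω)) = M →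
      ∀ x₁ ∈ K, ∀ x₂ ∈ K, x₁ ≠ x₂ →
        IntegrableOn (coulombIntegrand Ω α f x₁ x₂) (Set.univ.pi fun _ => Ω) ∧
        ‖coulombTwoPoint Ω α f x₁ x₂‖ ≤
          ‖x₁ - x₂‖ ^ (-(‖α‖ ^ 2 / (2 * Real.pi))) * C ^ (m + 2) *
            ((m + 2 : ℕ) : ℝ) ^ (‖α‖ ^ 2 / (8 * Real.pi) * ((m + 2 : ℕ) : ℝ)) := by
  -- No admissible data exist for the remaining values of the parameters.
  by_cases h : a ^ 2 < 4 * Real.pi ∧ IsCompact S ∧ S ⊆ Ω ∧ M ≠ ⊤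
  · obtain ⟨ha, hS, hSΩ, hM⟩ := h
    obtain ⟨C, hC, h_bound⟩ :=
      exists_coulombTwoPoint_le hΩ hΩb ha (hS.union hK) (Set.union_subset hSΩ hKΩ) hM
    refine ⟨C, hC, fun m α f _ hα hf hfS hfM x₁ h₁ x₂ h₂ hne => ?_⟩
    rw [hα]
    exact h_bound m α f (fun k => (norm_le_pi_norm α k).trans_eq hα) (fun j => (hf j).1.1)
      (fun j => (Set.subset_iUnion_of_subset j subset_rfl).trans
        (hfS.trans_subset Set.subset_union_left))
      (fun j => (le_iSup _ j).trans_eq hfM) x₁ (Or.inr h₁) x₂ (Or.inr h₂) hne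
  · refine ⟨1, one_pos, fun m α f hα ha hf hfS hfM => absurd ⟨?_, ?_, ?_, ?_⟩ h⟩
    · exact ha ▸ sq_norm_lt_of_mem_Ioo_sqrt (by positivity) hα
    · exact hfS ▸ isCompact_iUnion fun j => (hf j).2.1
    · exact hfS ▸ Set.iUnion_subset fun j => (hf j).2.2
    · rw [← hfM, ← Finset.sup_univ_eq_iSup]
      exact ((Finset.sup_lt_iff ENNReal.coe_lt_top).2 fun j _ => (hf j).1.2).ne

/-- The constant `C` depends only on `Ω`, `K`, `a = ‖α‖ = max_i |α_i|`, the union `S` of the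
supports and the largest `L^∞` norm `M`; the number of points is `n = m + 2 ≥ 3`. -/
theorem proposition3p7 (Ω : Set ℂ) (hΩ : IsOpen Ω) (hΩb : Bornology.IsBounded Ω)
    (hΩs : HasSmoothBoundary Ω) (K : Set ℂ) (hK : IsCompact K) (hKΩ : K ⊆ Ω)
    (a : ℝ) (S : Set ℂ) (M : ℝ≥0∞) :
    ∃ C : ℝ, 0 < C ∧ ∀ (m : ℕ), 1 ≤ m → ∀ (α : Fin (m + 2) → ℝ) (f : Fin m → ℂ → ℂ),
      (∀ i, α i ∈ Set.Ioo (-√(4 * Real.pi)) √(4 * Real.pi)) → ‖α‖ = a →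
      (∀ j, IsTestFunction Ω (f j)) → (⋃ j, tsupport (f j)) = S →
      (⨆ j, eLpNorm (f j) ∞ (volume.restrict Ω)) = M →
      ∀ x₁ ∈ K, ∀ x₂ ∈ K, x₁ ≠ x₂ →
        IntegrableOn (coulombIntegrand Ω α f x₁ x₂) (Set.univ.pi fun _ => Ω) ∧
        ‖coulombTwoPoint Ω α f x₁ x₂‖ ≤
          ‖x₁ - x₂‖ ^ (-(‖α‖ ^ 2 / (2 * Real.pi))) * C ^ (m + 2) *
            ((m + 2 : ℕ) : ℝ) ^ (‖α‖ ^ 2 / (8 * Real.pi) * ((m + 2 : ℕ) : ℝ)) := by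
  obtain ⟨C, hC, h_bound⟩ := proposition3p7_general Ω hΩ hΩb K hK hKΩ a S M
  exact ⟨C, hC, fun m _ α f hα ha hf => h_bound m α f hα ha fun j =>
    ⟨(hf j).1.continuous.memLp_top_of_hasCompactSupport (hf j).2.1 _, (hf j).2⟩⟩
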